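/- Let $p$ be a prime, let $k\ge 2$ be even and $n=k-2$. Fix embeddings of $\overline{\mathbb Q}$ into $\mathbb C$ and into $\mathbb C_p$, let $K\subset\mathbb C_p$ be the unramified quadratic extension of $\mathbb Q_p$, and let $\Gamma=\mathrm{SL}_2(\mathbb Z[1/p])$. An inert RM-point is a $\tau\in\overline{\mathbb Q}$, $\tau \notin\mathbb Q_p$, such that $\mathbb Q(\tau)$ is a real quadratic field in which $p$ is inert; $\overline\tau$ denotes its conjugate. Let $\mathcal D=\sum_i m_i[\tau_i]$ be an inert RM-divisor, that is, a finite formal $\mathbb{Z}$-linear combination of $\Gamma$-orbits of inert RM-points, and let $\varpi$ be the involution $[\tau]\mapsto-[p\tau]$ on such divisors. For $r,s\in\mathbb P^1(\mathbb Q)$ let $(w,\overline w)\cdot(r,s)\in\{-1,0,1\}$ be the signed intersection number of the geodesics of the complex upper half-plane from $w$ to $\overline w$ and from $r$ to $s$, and let $\Sigma_\tau\{r,s\}$ be the set of $w\in\Gamma\tau$ for which it is nonzero. The level of $w$ is the distance of its reduction, a vertex of the Bruhat–Tits tree of $\mathrm{GL}_2(\mathbb Q_p)$, from the standard vertex. For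 $l\ge 0$, $a\in\mathbb P^1(\mathbb F_p)$ and $r,s\in\mathbb P^1(\mathbb Q)$ define a $P_n(\mathbb C_p)$-valued measure by $$\Phi^{(a)}_{k,\mathcal D,l}\{r,s\}(U)=\sum_i\ \sum_{\substack{w\in\Sigma_{\tau_i}\{r,s\}\cap U\\ \mathrm{level}(w)=l,\ w\equiv a \bmod p}} m_i\,[(w,\overline w)\cdot(r,s)]\,\frac{(T-w)^{n/2}(T-\overline w)^{n/2}}{(w-\overline w)^{n/2}},$$ where $P_n(\mathbb C_p)$ is the space of polynomials of degree at most $n$, and define, for $z\in\mathbb C_p\setminus K$, $$F^{(a)}_{k,\mathcal D,l}\{r,s\}(z)=\Big\langle \Phi^{(a)}_{k,\mathcal D,l+1}\{r,s\},\ (t-z)^n\log_0(\ell_z(t))\Big\rangle,\qquad \ell_z(t)=\begin{cases}t-z&|t|\le 1,\\ 1-z/t&|t|>1.\end{cases}$$ Here $\log_0$ is the branch of the $p$-adic logarithm with $\log_0(p)=0$, and $\langle\mu,g\rangle$ is the integral of the locally analytic function $g$ against $\mu$: the limit, as $N\to\infty$, of the sum over the disks $U$ of radius $p^{-N}$ of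 $K$ of the pairings of $\mu(U)$ with the degree-$n$ Taylor polynomial of $g$ at a point of $U$, under the pairing $\langle T^i,T^j\rangle=(-1)^i\binom ni^{-1}\delta_{i+j,n}$ on $P_n(\mathbb{C}_p)$. For $\gamma=\begin{pmatrix}\alpha&\beta\\ c&d\end{pmatrix}\in\mathrm{GL}_2(\mathbb Q)$ of positive determinant let $(f|\gamma)(z)=\det(\gamma)^{(2-k)/2}(cz+d)^{k-2}f(\gamma z)$, and $(m|\gamma)\{r,s\}=m\{\gamma r,\gamma s\}|\gamma$ for a symbol $m$ with values in functions of $z$. Then for every $l\ge0$: (1) for every integer $a$, with class $a\in\mathbb F_p$, the function $$F^{(a)}_{k,-\varpi\mathcal D,l+1}\{0,\infty\}-\sum_{b\in\mathbb F_p}\Big(F^{(b)}_{k,\mathcal D,l}\,\Big|\,\begin{pmatrix}p&a\\0&1\end{pmatrix}^{-1}\Big)\{0,\infty\}$$ is, on $\mathbb C_p\setminus K$, a polynomial in $z$ of degree at most $n$; (2) the function $$F^{(\infty)}_{k,-\varpi\mathcal D,l+1}\{0,\infty\}-\Big(F^{(\infty)}_{k,\mathcal D,l}\,\Big|\,\begin{pmatrix}1&0\\0&p\end{pmatrix}^{-1}\Big)\{0,\infty\}-\sum_{b\in\mathbb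 F_p^\times}\Big(F^{(b)}_{k,\mathcal D,l}\,\Big|\,\begin{pmatrix}1&0\\0&p\end{pmatrix}^{-1}\Big)\{0,\infty\}$$ is, on $\mathbb C_p\setminus K$, a polynomial in $z$ of degree at most $n$. -/

import Mathlib

open scoped Polynomial OnePoint

namespace RMGreen

noncomputable section

open scoped NumberField
open Filter IntermediateField

set_option linter.unusedSectionVars false

/-! ### RM-points and RM-divisors -/

/-- The field of algebraic numbers. -/
abbrev Qbar : Type := AlgebraicClosure ℚ

/-- The ring `ℤ[1/p]`. -/
def ZInv (p : ℕ) : Subring ℚ := Subring.closure {(p : ℚ)⁻¹}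

/-- The Ihara group `Γ = SL₂(ℤ[1/p])`. -/
abbrev Ihara (p : ℕ) : Type := Matrix.SpecialLinearGroup (Fin 2) (ZInv p)

/-- The rational matrix underlying an element of `Γ`. -/
def Ihara.toMatrix {p : ℕ} (γ : Ihara p) : Matrix (Fin 2) (Fin 2) ℚ :=
  γ.1.map (ZInv p).subtype

/-- The Möbius transformation of a rational matrix at a (finite) point of an extension of `ℚ`. -/
def mobius {F : Type} [Field F] [CharZero F] (g : Matrix (Fin 2) (Fin 2) ℚ) (x : F) : F :=
  ((g 0 0 : F) * x + (g 0 1 : F)) / ((g 1 0 : F) * x + (g 1 1 : F))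

/-- The other root of the minimal polynomial `X² + b X + c` of a quadratic number. -/
def conj (τ : Qbar) : Qbar := algebraMap ℚ Qbar (-(minpoly ℚ τ).coeff 1) - τ

/-- `τ` is an inert RM-point: `τ` lies in the `p`-adic upper half-plane, `ℚ(τ)` is a real quadratic
field, and `p` is inert in it. -/
structure IsInertRM (p : ℕ) [Fact p.Prime] (ιinf : Qbar →+* ℂ) (ιp : Qbar →+* ℂ_[p])
    (τ : Qbar) : Prop where
  notMem_range : ιp τ ∉ Set.range (algebraMap ℚ_[p] ℂ_[p])
  finrank_eq : Module.finrank ℚ ℚ⟮τ⟯ = 2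
  real : (ιinf τ).im = 0
  inert : (Ideal.span {((p : ℕ) : 𝓞 ℚ⟮τ⟯)}).IsPrime

section Points

variable (p : ℕ) [Fact p.Prime] (ιinf : Qbar →+* ℂ) (ιp : Qbar →+* ℂ_[p])

/-- The set of inert RM-points. -/
abbrev RMPoint : Type := {τ : Qbar // IsInertRM p ιinf ιp τ}

variable {p ιinf ιp}

theorem RMPoint.ne_rat (τ : RMPoint p ιinf ιp) (q : ℚ) : (τ : Qbar) ≠ (q : Qbar) := by
  intro h
  apply τ.2.notMem_range
  refine ⟨(q : ℚ_[p]), ?_⟩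
  rw [h]
  simp

theorem RMPoint.denom_ne (τ : RMPoint p ιinf ιp) {c d : ℚ} (h : ¬ (c = 0 ∧ d = 0)) :
    (c : Qbar) * (τ : Qbar) + (d : Qbar) ≠ 0 := by
  intro h0
  by_cases hc : c = 0
  · subst hc
    have hd : (d : Qbar) = 0 := by simpa using h0
    exact h ⟨rfl, by exact_mod_cast hd⟩
  · apply τ.ne_rat (-d / c)
    have hc' : (c : Qbar) ≠ 0 := by exact_mod_cast hc
    push_cast
    rw [eq_div_iff hc']
    linear_combination h0

theorem Ihara.det_eq (γ : Ihara p) :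
    γ.toMatrix 0 0 * γ.toMatrix 1 1 - γ.toMatrix 0 1 * γ.toMatrix 1 0 = 1 := by
  have h := γ.2
  rw [Matrix.det_fin_two] at h
  have := congrArg (ZInv p).subtype h
  simpa [Ihara.toMatrix] using this

theorem Ihara.toMatrix_mul (γ δ : Ihara p) : (γ * δ).toMatrix = γ.toMatrix * δ.toMatrix := by
  ext i j
  simp [Ihara.toMatrix, Matrix.mul_apply, Fin.sum_univ_two]

theorem Ihara.bottom_ne (γ : Ihara p) : ¬ (γ.toMatrix 1 0 = 0 ∧ γ.toMatrix 1 1 = 0) := by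
  rintro ⟨h1, h2⟩
  have := γ.det_eq
  rw [h1, h2] at this
  simp at this

/-- Two inert RM-points are equivalent if they lie in the same `Γ`-orbit. -/
def RMPoint.Rel (τ τ' : RMPoint p ιinf ιp) : Prop :=
  ∃ γ : Ihara p, (τ' : Qbar) = mobius γ.toMatrix (τ : Qbar)

theorem RMPoint.rel_refl (τ : RMPoint p ιinf ιp) : τ.Rel τ :=
  ⟨1, by simp [mobius, Ihara.toMatrix]⟩

theorem RMPoint.rel_symm {τ τ' : RMPoint p ιinf ιp} (h : τ.Rel τ') : τ'.Rel τ := by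
  obtain ⟨γ, h⟩ := h
  refine ⟨γ⁻¹, ?_⟩
  have hd := τ.denom_ne γ.bottom_ne
  have hd' := τ'.denom_ne (γ⁻¹).bottom_ne
  have e00 : (γ⁻¹).toMatrix 0 0 = γ.toMatrix 1 1 := by
    simp [Ihara.toMatrix, Matrix.SpecialLinearGroup.coe_inv, Matrix.adjugate_fin_two]
  have e01 : (γ⁻¹).toMatrix 0 1 = -γ.toMatrix 0 1 := by
    simp [Ihara.toMatrix, Matrix.SpecialLinearGroup.coe_inv, Matrix.adjugate_fin_two]
  have e10 : (γ⁻¹).toMatrix 1 0 = -γ.toMatrix 1 0 := by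
    simp [Ihara.toMatrix, Matrix.SpecialLinearGroup.coe_inv, Matrix.adjugate_fin_two]
  have e11 : (γ⁻¹).toMatrix 1 1 = γ.toMatrix 0 0 := by
    simp [Ihara.toMatrix, Matrix.SpecialLinearGroup.coe_inv, Matrix.adjugate_fin_two]
  unfold mobius at h ⊢
  rw [e10, e11] at hd' ⊢
  rw [e00, e01, eq_div_iff hd']
  rw [eq_div_iff hd] at h
  push_cast at h ⊢
  linear_combination (-1 : Qbar) * h

theorem RMPoint.rel_trans {τ τ' τ'' : RMPoint p ιinf ιp} (h : τ.Rel τ') (h' : τ'.Rel τ'') :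
    τ.Rel τ'' := by
  obtain ⟨γ, h⟩ := h
  obtain ⟨δ, h'⟩ := h'
  refine ⟨δ * γ, ?_⟩
  have hd := τ.denom_ne γ.bottom_ne
  have hd1 := τ'.denom_ne δ.bottom_ne
  have hd2 := τ.denom_ne (δ * γ).bottom_ne
  unfold mobius at h h' ⊢
  rw [Ihara.toMatrix_mul] at hd2 ⊢
  simp only [Matrix.mul_apply, Fin.sum_univ_two] at hd2 ⊢
  rw [h', div_eq_div_iff hd1 hd2]
  rw [eq_div_iff hd] at h
  push_cast
  have hD : ((δ.toMatrix 0 0 : Qbar)) * δ.toMatrix 1 1 - δ.toMatrix 0 1 * δ.toMatrix 1 0 = 1 := by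
    exact_mod_cast congrArg (fun q : ℚ => (q : Qbar)) δ.det_eq
  linear_combination h * (δ.toMatrix 0 0 * δ.toMatrix 1 1 - δ.toMatrix 0 1 * δ.toMatrix 1 0)

variable (p ιinf ιp) in
/-- Equivalence of inert RM-points under `Γ`. -/
def RMPoint.setoid : Setoid (RMPoint p ιinf ιp) where
  r := RMPoint.Rel
  iseqv := ⟨RMPoint.rel_refl, RMPoint.rel_symm, RMPoint.rel_trans⟩

variable (p ιinf ιp) in
/-- The set of `Γ`-orbits of inert RM-points. -/
abbrev RMOrbit : Type := Quotient (RMPoint.setoid p ιinf ιp)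

/-- The orbit `[τ]`. -/
def RMPoint.orbit (τ : RMPoint p ιinf ιp) : RMOrbit p ιinf ιp :=
  Quotient.mk (RMPoint.setoid p ιinf ιp) τ

variable (p ιinf ιp) in
/-- The group of inert RM-divisors `∑ mᵢ [τᵢ]`. -/
abbrev RMDivisor : Type := RMOrbit p ιinf ιp →₀ ℤ

theorem adjoin_p_mul (p : ℕ) [Fact p.Prime] (τ : Qbar) :
    ℚ⟮(p : Qbar) * τ⟯ = ℚ⟮τ⟯ := by
  have hp : (p : Qbar) ≠ 0 := by exact_mod_cast (Fact.out : p.Prime).ne_zero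
  apply le_antisymm
  · rw [adjoin_simple_le_iff]
    exact mul_mem (_root_.natCast_mem _ p) (mem_adjoin_simple_self ℚ τ)
  · rw [adjoin_simple_le_iff]
    have h : (p : Qbar)⁻¹ * ((p : Qbar) * τ) ∈ ℚ⟮(p : Qbar) * τ⟯ :=
      mul_mem (inv_mem (_root_.natCast_mem _ p)) (mem_adjoin_simple_self ℚ _)
    rwa [inv_mul_cancel_left₀ hp] at h

/-- The RM-point `p τ`. -/
def RMPoint.mulP (τ : RMPoint p ιinf ιp) : RMPoint p ιinf ιp where
  val := (p : Qbar) * τ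
  property := by
    refine ⟨?_, ?_, ?_, ?_⟩
    · rintro ⟨q, hq⟩
      apply τ.2.notMem_range
      have hp : (p : ℂ_[p]) ≠ 0 := by exact_mod_cast (Fact.out : p.Prime).ne_zero
      refine ⟨(p : ℚ_[p])⁻¹ * q, ?_⟩
      rw [map_mul, hq, map_mul, map_inv₀, map_natCast, map_natCast, inv_mul_cancel_left₀ hp]
    · rw [adjoin_p_mul]
      exact τ.2.finrank_eq
    · rw [map_mul, map_natCast, Complex.mul_im, τ.2.real]
      simp
    · rw [adjoin_p_mul]
      exact τ.2.inert

theorem RMPoint.mulP_rel {τ τ' : RMPoint p ιinf ιp} (h : τ.Rel τ') : τ.mulP.Rel τ'.mulP := by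
  obtain ⟨γ, h⟩ := h
  have hp : (p : ℚ) ≠ 0 := by exact_mod_cast (Fact.out : p.Prime).ne_zero
  have hp' : (p : Qbar) ≠ 0 := by exact_mod_cast (Fact.out : p.Prime).ne_zero
  have hinv : (p : ℚ)⁻¹ ∈ ZInv p := Subring.subset_closure rfl
  let P : ZInv p := ⟨(p : ℚ), _root_.natCast_mem _ p⟩
  let Q : ZInv p := ⟨(p : ℚ)⁻¹, hinv⟩
  have hPQ : P * Q = 1 := Subtype.ext (mul_inv_cancel₀ hp)
  let δ : Ihara p := ⟨!![γ.1 0 0, P * γ.1 0 1; Q * γ.1 1 0, γ.1 1 1], by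
    have h2 := γ.2
    rw [Matrix.det_fin_two] at h2
    rw [Matrix.det_fin_two_of]
    linear_combination h2 - γ.1 0 1 * γ.1 1 0 * hPQ⟩
  refine ⟨δ, ?_⟩
  have hd := τ.denom_ne γ.bottom_ne
  have hd1 := τ.mulP.denom_ne δ.bottom_ne
  have e00 : δ.toMatrix 0 0 = γ.toMatrix 0 0 := rfl
  have e01 : δ.toMatrix 0 1 = p * γ.toMatrix 0 1 := rfl
  have e10 : δ.toMatrix 1 0 = (p : ℚ)⁻¹ * γ.toMatrix 1 0 := rfl
  have e11 : δ.toMatrix 1 1 = γ.toMatrix 1 1 := rfl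
  unfold mobius at h ⊢
  rw [eq_div_iff hd1]
  rw [eq_div_iff hd] at h
  rw [e00, e01, e10, e11]
  change (p : Qbar) * τ' * (_ * ((p : Qbar) * τ) + _) = _ * ((p : Qbar) * τ) + _
  push_cast
  field_simp
  linear_combination h

/-- The map `[τ] ↦ [p τ]` on orbits. -/
def RMOrbit.mulP : RMOrbit p ιinf ιp → RMOrbit p ιinf ιp :=
  Quotient.map RMPoint.mulP fun _ _ h => RMPoint.mulP_rel h

/-- The involution `ϖ : [τ] ↦ -[p τ]` on inert RM-divisors. -/
def varpi : RMDivisor p ιinf ιp →+ RMDivisor p ιinf ιp :=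
  -(Finsupp.mapDomain.addMonoidHom RMOrbit.mulP : RMDivisor p ιinf ιp →+ RMDivisor p ιinf ιp)

end Points

/-! ### Intersection numbers -/

/-- For the geodesic of the complex upper half-plane oriented from `α` to `β` (distinct real
numbers), the cusp `c`, different from `α` and `β`, lies on its left. -/
def OnLeft (α β : ℝ) : OnePoint ℚ → Prop
  | ∞ => α < β
  | (c : ℚ) => (β < (c : ℝ) ∧ (c : ℝ) < α) ∨ (α < β ∧ ((c : ℝ) < α ∨ β < (c : ℝ)))

open Classical in
/-- The signed intersection number `(α, β) · (r, s)` of the geodesic from `α` to `β` with the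
geodesic from `r` to `s`: it is `1` (resp. `-1`) if the second one crosses the first one from
right to left (resp. from left to right), so that the two tangent vectors at the intersection
form a positively (resp. negatively) oriented basis, and `0` if they do not intersect. -/
def geodesicInter (α β : ℝ) (r s : OnePoint ℚ) : ℤ :=
  (if OnLeft α β s then 1 else 0) - (if OnLeft α β r then 1 else 0)

section Symbols

variable {p : ℕ} [Fact p.Prime] {ιinf : Qbar →+* ℂ} {ιp : Qbar →+* ℂ_[p]}

/-- The intersection number `(w, w̄) · (r, s)`. -/
def RMPoint.inter (w : RMPoint p ιinf ιp) (r s : OnePoint ℚ) : ℤ :=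
  geodesicInter (ιinf w).re (ιinf (conj w)).re r s

/-- The set `Σ_τ{r,s}` of the points `w` of the orbit `[τ]` with `(w, w̄) · (r, s) ≠ 0`. -/
def RMOrbit.sigma (o : RMOrbit p ιinf ιp) (r s : OnePoint ℚ) : Set (RMPoint p ιinf ιp) :=
  {w | w.orbit = o ∧ w.inter r s ≠ 0}

/-- The polynomial `(T-w)^{n/2} (T-w̄)^{n/2} / (w-w̄)^{n/2}` in `P_n(ℂ_p)`. -/
def RMPoint.poly (n : ℕ) (w : RMPoint p ιinf ιp) : ℂ_[p][X] :=
  Polynomial.C (((ιp w - ιp (conj w)) ^ (n / 2))⁻¹) *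
    ((Polynomial.X - Polynomial.C (ιp w)) ^ (n / 2) *
      (Polynomial.X - Polynomial.C (ιp (conj w))) ^ (n / 2))

/-! ### Level and reduction -/

/-- `|x₀ y₁ - x₁ y₀|` for primitive homogeneous coordinates `[x₀ : x₁]`, `[y₀ : y₁]` of the points
`x ∈ ℂ_p` and `y ∈ ℙ¹(ℚ_p)`. -/
def chordal (x : ℂ_[p]) : OnePoint ℚ_[p] → ℝ
  | ∞ => 1 / max 1 ‖x‖
  | (y : ℚ_[p]) => ‖x - algebraMap ℚ_[p] ℂ_[p] y‖ / (max 1 ‖x‖ * max 1 ‖y‖)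

/-- The reduction of `x` to the Bruhat–Tits tree of `ℚ_p` is a vertex `v` of level `l`: the smallest
ball around `x` which meets `ℙ¹(ℚ_p)` has radius `p^{-l}`. (Its intersection with `ℙ¹(ℚ_p)` is the
disk `U_v`, and the disks `U_v` of the vertices at distance `l` from the standard vertex are the
balls of radius `p^{-l}` of `ℙ¹(ℚ_p)`.) -/
def HasLevel (x : ℂ_[p]) (l : ℕ) : Prop :=
  IsLeast (Set.range (chordal x)) ((p : ℝ) ^ (-(l : ℤ)))

/-- `x ≡ a mod p`, where `a ∈ ℙ¹(𝔽_p)`. -/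
def Reduces (x : ℂ_[p]) : OnePoint (ZMod p) → Prop
  | ∞ => 1 < ‖x‖
  | (a : ZMod p) => ‖x - (a.val : ℂ_[p])‖ < 1

/-- The truncated measure `Φ_{k,D,l}^{(a)}{r,s}`. An oriented edge `e` enters only through the disk
`U = U_e`. -/
def Phi (k : ℕ) (D : RMDivisor p ιinf ιp) (l : ℕ) (a : OnePoint (ZMod p)) (r s : OnePoint ℚ)
    (U : Set ℂ_[p]) : ℂ_[p][X] :=
  D.sum fun o m => m • ∑ᶠ (w : RMPoint p ιinf ιp)
    (_ : w ∈ o.sigma r s ∧ ιp w ∈ U ∧ HasLevel (ιp w) l ∧ Reduces (ιp w) a),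
      w.inter r s • w.poly (k - 2)

end Symbols

/-! ### The `p`-adic logarithm -/

section Analysis

variable {p : ℕ} [Fact p.Prime]

/-- The series `log (1 + x) = ∑ (-1)^m x^{m+1} / (m+1)`, for `‖x‖ < 1`. -/
def logSeries (x : ℂ_[p]) : ℂ_[p] :=
  ∑' m : ℕ, (-1) ^ m * x ^ (m + 1) / ((m : ℂ_[p]) + 1)

open Classical in
/-- The branch `log_𝓛` of the `p`-adic logarithm with `log_𝓛 p = 𝓛`. Each `x ≠ 0` has a power
`x ^ N`, `N > 0`, of the form `p ^ s * (1 + y)` with `‖y‖ < 1`, and then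
`log_𝓛 x = (log (1 + y) + s 𝓛) / N`. -/
def logBranch (𝓛 x : ℂ_[p]) : ℂ_[p] :=
  if h : ∃ q : ℕ × ℤ, 0 < q.1 ∧ ‖x ^ q.1 * (p : ℂ_[p]) ^ (-q.2) - 1‖ < 1 then
    (logSeries (x ^ h.choose.1 * (p : ℂ_[p]) ^ (-h.choose.2) - 1) + (h.choose.2 : ℂ_[p]) * 𝓛) / (h.choose.1 : ℂ_[p])
  else 0

/-! ### Integration of locally analytic functions -/

variable (p) in
/-- The unramified quadratic extension `K` of `ℚ_p` inside `ℂ_p`, which is generated by the roots of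
unity of order dividing `p² - 1`. -/
def unramK : IntermediateField ℚ_[p] ℂ_[p] :=
  IntermediateField.adjoin ℚ_[p] {ζ : ℂ_[p] | ζ ^ (p ^ 2 - 1) = 1}

/-- The pairing on `P_n` with `⟨T^i, T^j⟩ = (-1)^i (n choose i)⁻¹ δ_{n,i+j}`. -/
def polyPairing (n : ℕ) (f g : ℂ_[p][X]) : ℂ_[p] :=
  ∑ i ∈ Finset.range (n + 1), (-1) ^ i * (n.choose i : ℂ_[p])⁻¹ * f.coeff i * g.coeff (n - i)

/-- The Taylor polynomial of degree `n` of `g` at `x`. -/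
def taylorPoly (n : ℕ) (g : ℂ_[p] → ℂ_[p]) (x : ℂ_[p]) : ℂ_[p][X] :=
  ∑ j ∈ Finset.range (n + 1), Polynomial.C (iteratedDeriv j g x / (j.factorial : ℂ_[p])) *
    (Polynomial.X - Polynomial.C x) ^ j

variable (p) in
/-- The disks of radius `p^{-N}` in `K`. -/
def disks (N : ℕ) : Set (Set ℂ_[p]) :=
  {U | ∃ x ∈ unramK p, U = {t | t ∈ unramK p ∧ ‖t - x‖ ≤ (p : ℝ) ^ (-(N : ℤ))}}

/-- The pairing `⟨μ, g⟩ = ∫ g dμ` of a `P_n`-valued measure `μ` (with bounded support in `K`) and a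
function `g` which is locally analytic on `K`. On each disk of a covering of `K` by disks of radius
`p^{-N}`, the function `g` is approximated by its Taylor polynomial of degree `n` at a point of the
disk, which pairs with the value of `μ` on that disk; then `N` tends to infinity. -/
def integral (n : ℕ) (μ : Set ℂ_[p] → ℂ_[p][X]) (g : ℂ_[p] → ℂ_[p]) : ℂ_[p] :=
  limUnder atTop fun N : ℕ =>
    ∑ᶠ U ∈ disks p N, polyPairing n (taylorPoly n g (Classical.epsilon fun x => x ∈ U)) (μ U)

open Classical in
/-- The function of `t` given by `(t-z)^n log_0(t-z)` for `|t| ≤ 1`, and by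
`(t-z)^n log_0(1-z/t)` for `|t| > 1`. -/
def logKernel (n : ℕ) (z t : ℂ_[p]) : ℂ_[p] :=
  (t - z) ^ n * logBranch 0 (if ‖t‖ ≤ 1 then t - z else 1 - z / t)

/-- The truncated primitive `F_{k,D,l}^{(a)}{r,s}`, as a function of `z`. -/
def F {ιinf : Qbar →+* ℂ} {ιp : Qbar →+* ℂ_[p]} (k : ℕ) (D : RMDivisor p ιinf ιp) (l : ℕ)
    (a : OnePoint (ZMod p)) (r s : OnePoint ℚ) (z : ℂ_[p]) : ℂ_[p] :=
  integral (k - 2) (Phi k D (l + 1) a r s) (logKernel (k - 2) z)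

/-! ### Slash actions -/

/-- The weight `κ` action `(f|γ)(z) = det(γ)^{κ/2} (c z + d)^{-κ} f(γ z)`, for even `κ`. -/
def slashFun (κ : ℤ) (f : ℂ_[p] → ℂ_[p]) (γ : GL (Fin 2) ℚ) (z : ℂ_[p]) : ℂ_[p] :=
  ((γ.1.det : ℚ) : ℂ_[p]) ^ (κ / 2) *
    (((γ.1 1 0 : ℚ) : ℂ_[p]) * z + ((γ.1 1 1 : ℚ) : ℂ_[p])) ^ (-κ) * f (mobius γ.1 z)

/-- The action `(m|γ){r,s} = m{γ r, γ s}|γ` on symbols valued in functions of weight `κ`. -/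
def slashSymbol (κ : ℤ) (m : OnePoint ℚ → OnePoint ℚ → ℂ_[p] → ℂ_[p]) (γ : GL (Fin 2) ℚ)
    (r s : OnePoint ℚ) : ℂ_[p] → ℂ_[p] :=
  slashFun κ (m (γ • r) (γ • s)) γ

variable (p) in
/-- The matrix `(p a; 0 1)`. -/
def matUpper (a : ℤ) : GL (Fin 2) ℚ :=
  Matrix.GeneralLinearGroup.mkOfDetNeZero !![(p : ℚ), (a : ℚ); 0, 1] (by
    simpa using (Fact.out : p.Prime).ne_zero)

variable (p) in
/-- The matrix `(1 0; 0 p)`. -/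
def matLower : GL (Fin 2) ℚ :=
  Matrix.GeneralLinearGroup.mkOfDetNeZero !![(1 : ℚ), 0; 0, (p : ℚ)] (by
    simpa using (Fact.out : p.Prime).ne_zero)

end Analysis

end

end RMGreen

open RMGreen

open scoped Polynomial OnePoint

namespace RMGreen

noncomputable section

open scoped NumberField
open Filter IntermediateField

set_option linter.unusedSectionVars false

/-! ### The `p`-adic logarithm -/

section Logarithm

open Topology

variable {p : ℕ} [hp : Fact p.Prime]

/-! Every `F` in the statement is a finite sum over RM-points. If only finitely many points `w` of
`K` contribute to the measure, it is a sum of polynomial-valued Dirac measures; a disk of radius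
`p^{-N}` shrinks to such a point, so the integral is the sum of the pairings of `w.poly n` with the
Taylor polynomial of the kernel at `w` (`integral_eq_sum`, `F_eq_finsum`). Since `z` lies outside
`K`, the kernel is analytic at all these points; this needs `log_0` to be a homomorphism on nonzero
elements (`logBranch_mul`), which also makes it locally analytic.

Finiteness for the path from `0` to `∞` (`finite_orbit_level`): the points of one orbit are roots of
forms `(A, B, C)` over `ℤ[1/p]` of one discriminant `Δ`. Fixing the level bounds the denominators of
the coefficients, and crossing the path forces `A * C ≤ 0`, so `B²` and `4|AC|` are at most `Δ`.
This leaves finitely many forms.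

The recursion comes from the substitution `w ↦ p w + a`. It carries the orbit of `w` to that of `p
w`, matching `-ϖ`; it preserves intersection numbers once the cusps are moved along; it raises by
one the level of integral points of positive level, with image the points of the next level
congruent to `a` (`hasLevel_affine_iff`). On integral points the kernel is `(t - z)^n log_0 (t -
z)`, and `log_0 p = 0` makes it homogeneous under this substitution. Hence in (1) the two sides
agree term by term and the polynomial is `0`.

In (2) the substitution is `w ↦ p w`, from points of level `l + 2` reducing to `∞` onto points of
level `l + 1` of norm at least `1`. Where `|p w| > 1`, the quotient `z / t` in the kernel is
unchanged. Where `|p w| = 1`, the kernel switches from `1 - z/t` to `t - z`, and `log_0 (t - z) =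
log_0 (1 - z/t) + log_0 t`. The excess term is a pairing with `(t - z)^n log_0 t`, which is a
polynomial in `z` of degree at most `n` by the binomial theorem (`exists_polynomial_pointPairing`).
-/

theorem norm_algebraMap_padic (x : ℚ_[p]) : ‖algebraMap ℚ_[p] ℂ_[p] x‖ = ‖x‖ :=
  norm_algebraMap' _ _

theorem norm_natCast_eq (m : ℕ) : ‖(m : ℂ_[p])‖ = ‖(m : ℚ_[p])‖ := by
  rw [← norm_algebraMap_padic (p := p), map_natCast]

theorem norm_prime : ‖(p : ℂ_[p])‖ = (p : ℝ)⁻¹ := by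
  rw [norm_natCast_eq, Padic.norm_p]

theorem prime_ne_zero : (p : ℂ_[p]) ≠ 0 := by
  exact_mod_cast hp.out.ne_zero

/-- The inverse norm is the power of `p` dividing `m`, hence at most `m`; this controls the
denominators of the logarithmic series. -/
theorem inv_norm_natCast_le {m : ℕ} (hm : m ≠ 0) : ‖(m : ℂ_[p])‖⁻¹ ≤ m := by
  have hm' : (m : ℚ_[p]) ≠ 0 := by exact_mod_cast hm
  rw [norm_natCast_eq, Padic.norm_eq_zpow_neg_valuation hm', Padic.valuation_natCast, zpow_neg,
    inv_inv, zpow_natCast]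
  exact_mod_cast Nat.le_of_dvd (Nat.pos_of_ne_zero hm) pow_padicValNat_dvd

theorem norm_eq_one_of_norm_sub_one_lt {u : ℂ_[p]} (hu : ‖u - 1‖ < 1) : ‖u‖ = 1 := by
  have h := IsUltrametricDist.norm_add_eq_max_of_norm_ne_norm (x := u - 1) (y := 1)
    (by simpa using hu.ne)
  rw [sub_add_cancel, norm_one] at h
  rw [h, max_eq_right hu.le]

theorem norm_mul_sub_one_lt {u v : ℂ_[p]} (hu : ‖u - 1‖ < 1) (hv : ‖v - 1‖ < 1) :
    ‖u * v - 1‖ < 1 := by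
  have e : u * v - 1 = u * (v - 1) + (u - 1) := by ring
  rw [e]
  refine (IsUltrametricDist.norm_add_le_max _ _).trans_lt (max_lt ?_ hu)
  rwa [norm_mul, norm_eq_one_of_norm_sub_one_lt hu, one_mul]

theorem norm_pow_sub_one_lt {u : ℂ_[p]} (hu : ‖u - 1‖ < 1) (m : ℕ) : ‖u ^ m - 1‖ < 1 := by
  induction m with
  | zero => simp
  | succ m ih => rw [pow_succ]; exact norm_mul_sub_one_lt ih hu

theorem tendsto_prime_pow : Tendsto (fun N : ℕ => (p : ℂ_[p]) ^ N) atTop (𝓝 0) := by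
  apply tendsto_pow_atTop_nhds_zero_of_norm_lt_one
  rw [norm_prime]
  exact inv_lt_one_of_one_lt₀ (by exact_mod_cast hp.out.one_lt)

/-- The binomial coefficient is the product of the `(p^N - j) / j` for `1 ≤ j ≤ m`, and each factor
tends to `-1`. -/
theorem tendsto_choose_prime_pow (m : ℕ) :
    Tendsto (fun N : ℕ => ((p ^ N - 1).choose m : ℂ_[p])) atTop (𝓝 ((-1) ^ m)) := by
  induction m with
  | zero => simp
  | succ m ih =>
    have hm : ((m : ℂ_[p]) + 1) ≠ 0 := by exact_mod_cast m.succ_ne_zero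
    have key : ∀ᶠ N : ℕ in atTop, ((p ^ N - 1).choose m : ℂ_[p]) *
        (((p : ℂ_[p]) ^ N - 1 - m) / (m + 1)) = ((p ^ N - 1).choose (m + 1) : ℂ_[p]) := by
      filter_upwards [eventually_ge_atTop (m + 1)] with N hN
      have h1 : m + 1 ≤ p ^ N := hN.trans (Nat.lt_pow_self hp.out.one_lt).le
      have h2 := Nat.choose_succ_right_eq (p ^ N - 1) m
      have h3 : ((p ^ N - 1 - m : ℕ) : ℂ_[p]) = (p : ℂ_[p]) ^ N - 1 - m := by
        rw [Nat.cast_sub (by omega), Nat.cast_sub (by omega)]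
        push_cast; ring
      have h4 := congrArg (Nat.cast (R := ℂ_[p])) h2
      push_cast at h4
      rw [h3] at h4
      field_simp
      linear_combination -h4
    refine Tendsto.congr' key ?_
    have h := ih.mul (((tendsto_prime_pow (p := p)).sub_const (1 : ℂ_[p])).sub_const
      (m : ℂ_[p]) |>.div_const ((m : ℂ_[p]) + 1))
    convert h using 2
    rw [pow_succ]
    field_simp
    ring

theorem summable_succ_mul_pow {r : ℝ} (h0 : 0 ≤ r) (h1 : r < 1) :
    Summable fun m : ℕ => ((m : ℝ) + 1) * r ^ (m + 1) := by
  have h := summable_pow_mul_geometric_of_norm_lt_one (R := ℝ) 1 (r := r)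
    (by rwa [Real.norm_of_nonneg h0])
  have := (summable_nat_add_iff 1).2 h
  simpa using this

/-- The logarithm `log u = ∑ (-1)^m (u - 1)^(m + 1) / (m + 1)` is the limit of
`(u ^ (p ^ N) - 1) / p ^ N`. -/
theorem tendsto_logSeries {u : ℂ_[p]} (hu : ‖u - 1‖ < 1) :
    Tendsto (fun N : ℕ => (u ^ p ^ N - 1) / (p : ℂ_[p]) ^ N) atTop (𝓝 (logSeries (u - 1))) := by
  set x := u - 1 with hx
  have hp0 : (p : ℂ_[p]) ≠ 0 := prime_ne_zero
  -- Binomial expansion of `(1 + x)^(p^N)`, using that `choose (p^N) (m+1) / p^N` equals `choose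
  -- (p^N - 1) m / (m+1)`.
  have hsum : ∀ N : ℕ, (u ^ p ^ N - 1) / (p : ℂ_[p]) ^ N
      = ∑' m : ℕ, ((p ^ N - 1).choose m : ℂ_[p]) * x ^ (m + 1) / ((m : ℂ_[p]) + 1) := by
    intro N
    have hpos : 0 < p ^ N := pow_pos hp.out.pos N
    rw [tsum_eq_sum (s := Finset.range (p ^ N))]
    · have e : u = x + 1 := by rw [hx]; ring
      rw [e, add_pow, Finset.sum_range_succ']
      simp only [one_pow, mul_one, pow_zero, Nat.choose_zero_right, Nat.cast_one,
        add_sub_cancel_right]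
      rw [Finset.sum_div]
      refine Finset.sum_congr rfl fun m _ => ?_
      have hm : ((m : ℂ_[p]) + 1) ≠ 0 := by exact_mod_cast m.succ_ne_zero
      have h := Nat.add_one_mul_choose_eq (p ^ N - 1) m
      rw [Nat.sub_add_cancel hpos] at h
      have h' := congrArg (Nat.cast (R := ℂ_[p])) h
      push_cast at h'
      field_simp
      linear_combination (-x ^ (m + 1)) * h'
    · intro m hm
      rw [Finset.mem_range, not_lt] at hm
      rw [Nat.choose_eq_zero_of_lt (by omega)]
      simp
  simp_rw [hsum]
  refine tendsto_tsum_of_dominated_convergence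
    (summable_succ_mul_pow (norm_nonneg x) hu) ?_ ?_
  · intro m
    exact ((tendsto_choose_prime_pow m).mul_const _).div_const _
  · refine Eventually.of_forall fun N m => ?_
    have hm := inv_norm_natCast_le (p := p) m.succ_ne_zero
    push_cast at hm
    rw [norm_div, norm_mul, norm_pow, div_eq_mul_inv]
    have h1 := IsUltrametricDist.norm_natCast_le_one ℂ_[p] ((p ^ N - 1).choose m)
    calc _ ≤ 1 * ‖x‖ ^ (m + 1) * ((m : ℝ) + 1) := by gcongr
      _ = _ := by ring

/-- Divide `(uv)^q - 1 = (u^q - 1) v^q + (v^q - 1)` by `q = p^N` and let `N` grow; `v^q` tends to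
`1`. -/
theorem logSeries_mul {u v : ℂ_[p]} (hu : ‖u - 1‖ < 1) (hv : ‖v - 1‖ < 1) :
    logSeries (u * v - 1) = logSeries (u - 1) + logSeries (v - 1) := by
  have hp0 : (p : ℂ_[p]) ≠ 0 := prime_ne_zero
  have h1 := tendsto_logSeries (norm_mul_sub_one_lt hu hv)
  have hu' := tendsto_logSeries hu
  have hv' := tendsto_logSeries hv
  have hv1 : Tendsto (fun N : ℕ => v ^ p ^ N) atTop (𝓝 1) := by
    have h := (hv'.mul (tendsto_prime_pow (p := p))).add_const 1
    simp only [mul_zero, zero_add] at h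
    refine h.congr fun N => ?_
    field_simp
    ring
  have h2 := (hu'.mul hv1).add hv'
  rw [mul_one] at h2
  refine tendsto_nhds_unique (h1.congr fun N => ?_) h2
  rw [mul_pow]
  field_simp
  ring

theorem logSeries_one : logSeries ((1 : ℂ_[p]) - 1) = 0 := by
  have h := logSeries_mul (u := (1 : ℂ_[p])) (v := 1) (by simp) (by simp)
  rw [mul_one] at h
  simpa using h

theorem logSeries_pow {u : ℂ_[p]} (hu : ‖u - 1‖ < 1) (m : ℕ) :
    logSeries (u ^ m - 1) = (m : ℂ_[p]) * logSeries (u - 1) := by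
  induction m with
  | zero => simpa using logSeries_one
  | succ m ih =>
    rw [pow_succ, logSeries_mul (norm_pow_sub_one_lt hu m) hu, ih]
    push_cast; ring

/-- The logarithmic series is analytic at the origin. -/
theorem analyticAt_logSeries : AnalyticAt ℂ_[p] (logSeries (p := p)) 0 := by
  -- The index is one more than in `logSeries`; division by zero gives `c 0 = 0`, the missing
  -- constant term.
  let c : ℕ → ℂ_[p] := fun m => (-1) ^ (m + 1) / m
  have hc : ∀ m, ‖c m‖ ≤ m := by
    intro m
    rcases eq_or_ne m 0 with rfl | hm
    · simp [c]
    · have := inv_norm_natCast_le (p := p) hm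
      simpa [c] using this
  let P := FormalMultilinearSeries.ofScalars ℂ_[p] c
  have hr : ((1 / 2 : NNReal) : ENNReal) ≤ P.radius := by
    refine P.le_radius_of_bound 1 fun m => ?_
    have h1 : ‖P m‖ ≤ m := by
      rw [FormalMultilinearSeries.ofScalars_norm]
      exact hc m
    have h2 : (m : ℝ) ≤ 2 ^ m := by exact_mod_cast (Nat.lt_two_pow_self (n := m)).le
    calc ‖P m‖ * ((1 / 2 : NNReal) : ℝ) ^ m ≤ 2 ^ m * ((1 / 2 : NNReal) : ℝ) ^ m := by
          gcongr; exact h1.trans h2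
      _ = 1 := by rw [← mul_pow]; norm_num
  have hpos : 0 < P.radius := lt_of_lt_of_le (by norm_num) hr
  have hP := (P.hasFPowerSeriesOnBall hpos).analyticAt
  refine hP.congr ?_
  have hball : ∀ᶠ x : ℂ_[p] in 𝓝 0, ‖x‖ < 1 := by
    filter_upwards [Metric.ball_mem_nhds (0 : ℂ_[p]) one_pos] with x hx
    simpa using hx
  filter_upwards [hball] with x hx
  have hs : Summable fun m : ℕ => c m * x ^ m := by
    refine Summable.of_norm_bounded (g := fun m : ℕ => (m : ℝ) * ‖x‖ ^ m) ?_ fun m => ?_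
    · simpa using summable_pow_mul_geometric_of_norm_lt_one (R := ℝ) 1 (r := ‖x‖) (by simpa using hx)
    · rw [norm_mul, norm_pow]
      gcongr
      exact hc m
  change FormalMultilinearSeries.ofScalarsSum c x = _
  rw [FormalMultilinearSeries.ofScalarsSum_eq_tsum]
  simp only [smul_eq_mul]
  rw [hs.tsum_eq_zero_add, logSeries]
  simp only [c, Nat.cast_zero, div_zero, zero_mul, zero_add]
  refine tsum_congr fun m => ?_
  push_cast
  ring

/-- An element of `ℂ_p` of which a positive power is, up to a power of `p`, a principal unit. -/
def IsLogPair (x : ℂ_[p]) (q : ℕ × ℤ) : Prop :=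
  0 < q.1 ∧ ‖x ^ q.1 * (p : ℂ_[p]) ^ (-q.2) - 1‖ < 1

/-- Independence of the chosen pair: raise both principal units to a common power of `x`. They then
differ by a power of `p`, which must be trivial because principal units have norm `1`. -/
theorem logBranch_eq {x : ℂ_[p]} {q : ℕ × ℤ} (hq : IsLogPair x q) :
    logBranch 0 x = logSeries (x ^ q.1 * (p : ℂ_[p]) ^ (-q.2) - 1) / (q.1 : ℂ_[p]) := by
  have h : ∃ q : ℕ × ℤ, 0 < q.1 ∧ ‖x ^ q.1 * (p : ℂ_[p]) ^ (-q.2) - 1‖ < 1 := ⟨q, hq⟩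
  rw [logBranch, dif_pos h, mul_zero, add_zero]
  obtain ⟨h1, h2⟩ := h.choose_spec
  set q' := h.choose
  obtain ⟨h3, h4⟩ := hq
  have hp0 : (p : ℂ_[p]) ≠ 0 := prime_ne_zero
  have e : (x ^ q.1 * (p : ℂ_[p]) ^ (-q.2)) ^ q'.1
      = (x ^ q'.1 * (p : ℂ_[p]) ^ (-q'.2)) ^ q.1 * (p : ℂ_[p]) ^ (q'.2 * q.1 - q.2 * q'.1) := by
    rw [mul_pow, mul_pow, ← pow_mul, ← pow_mul, mul_comm q.1, mul_assoc]
    congr 1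
    rw [← zpow_natCast ((p : ℂ_[p]) ^ (-q.2)), ← zpow_natCast ((p : ℂ_[p]) ^ (-q'.2)),
      ← zpow_mul, ← zpow_mul, ← zpow_add₀ hp0]
    congr 1
    ring
  have hn := congrArg norm e
  rw [norm_mul, norm_eq_one_of_norm_sub_one_lt (norm_pow_sub_one_lt h4 _),
    norm_eq_one_of_norm_sub_one_lt (norm_pow_sub_one_lt h2 _), one_mul, norm_zpow, norm_prime] at hn
  have hz : q'.2 * q.1 - q.2 * q'.1 = 0 := by
    by_contra hne
    have hp1 : ((p : ℝ)⁻¹) ≠ 1 := by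
      simpa using hp.out.one_lt.ne'
    have hpos : (0 : ℝ) < (p : ℝ)⁻¹ := by
      have := hp.out.pos
      positivity
    rcases (zpow_eq_one_iff_right₀ hpos.le hp1).1 hn.symm with h
    exact hne h
  rw [hz, zpow_zero, mul_one] at e
  have h5 := logSeries_pow h4 q'.1
  have h6 := logSeries_pow h2 q.1
  rw [e, h6] at h5
  have c1 : (q.1 : ℂ_[p]) ≠ 0 := by exact_mod_cast h3.ne'
  have c2 : (q'.1 : ℂ_[p]) ≠ 0 := by exact_mod_cast h1.ne'
  field_simp
  linear_combination h5

/-- The norm of `y` is the `d`-th root of the norm of the constant coefficient of its minimal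
polynomial, `d` being the degree. -/
theorem exists_norm_pow_eq {y : PadicAlgCl p} (hy : y ≠ 0) :
    ∃ (m : ℕ) (s : ℤ), 0 < m ∧ ‖y‖ ^ m = (p : ℝ) ^ s := by
  have hint : IsIntegral ℚ_[p] y := Algebra.IsIntegral.isIntegral y
  have hc := minpoly.coeff_zero_ne_zero hint hy
  refine ⟨(minpoly ℚ_[p] y).natDegree, -((minpoly ℚ_[p] y).coeff 0).valuation,
    minpoly.natDegree_pos hint, ?_⟩
  rw [← Padic.norm_eq_zpow_neg_valuation hc, ← PadicAlgCl.spectralNorm_eq,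
    spectralNorm.spectralNorm_eq_norm_coeff_zero_rpow, one_div,
    Real.rpow_inv_natCast_pow (norm_nonneg _) (minpoly.natDegree_pos hint).ne']

/-- The powers of `u` lie in the unit ball of a finite-dimensional, hence locally compact,
`ℚ_p`-space, so two of them are at distance less than `1`. -/
theorem exists_pow_sub_one_norm_lt {u : PadicAlgCl p} (hu : ‖u‖ = 1) :
    ∃ m : ℕ, 0 < m ∧ ‖u ^ m - 1‖ < 1 := by
  let S : Submodule ℚ_[p] (PadicAlgCl p) := Subalgebra.toSubmodule (Algebra.adjoin ℚ_[p] {u})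
  have hfin : FiniteDimensional ℚ_[p] S :=
    Module.Finite.of_fg (Algebra.IsIntegral.isIntegral u).fg_adjoin_singleton
  have hprop : ProperSpace S := FiniteDimensional.proper ℚ_[p] S
  let f : ℕ → S := fun m => ⟨u ^ m, pow_mem (Algebra.self_mem_adjoin_singleton ℚ_[p] u) m⟩
  have hf : ∀ m, f m ∈ Metric.closedBall (0 : S) 1 := by
    intro m
    rw [mem_closedBall_zero_iff]
    change ‖u ^ m‖ ≤ 1
    rw [norm_pow, hu, one_pow]
  obtain ⟨a, -, φ, hφ, hlim⟩ := (isCompact_closedBall (0 : S) 1).tendsto_subseq hf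
  obtain ⟨N, hN⟩ := Metric.cauchySeq_iff'.1 hlim.cauchySeq 1 one_pos
  have h := hN (N + 1) N.le_succ
  have hlt : φ N < φ (N + 1) := hφ N.lt_succ_self
  refine ⟨φ (N + 1) - φ N, Nat.sub_pos_of_lt hlt, ?_⟩
  rw [dist_eq_norm] at h
  change ‖u ^ φ (N + 1) - u ^ φ N‖ < 1 at h
  have e : u ^ φ (N + 1) - u ^ φ N = u ^ φ N * (u ^ (φ (N + 1) - φ N) - 1) := by
    rw [mul_sub, ← pow_add, Nat.add_sub_cancel' hlt.le, mul_one]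
  rwa [e, norm_mul, norm_pow, hu, one_pow, one_mul] at h

/-- By density `x` is an algebraic number times a principal unit, and algebraic numbers are covered
by the two preceding lemmas. -/
theorem exists_isLogPair {x : ℂ_[p]} (hx : x ≠ 0) : ∃ q, IsLogPair x q := by
  obtain ⟨y, hy⟩ : ∃ y : PadicAlgCl p, ‖x - (y : ℂ_[p])‖ < ‖x‖ := by
    have h := UniformSpace.Completion.denseRange_coe (α := PadicAlgCl p)
    obtain ⟨y, hy⟩ := h.exists_dist_lt x (norm_pos_iff.2 hx)
    exact ⟨y, by rwa [dist_eq_norm] at hy⟩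
  have hy0 : y ≠ 0 := by
    rintro rfl
    simp at hy
  have hyC : (y : ℂ_[p]) ≠ 0 := by
    rw [← norm_ne_zero_iff, PadicComplex.norm_extends]
    exact norm_ne_zero_iff.2 hy0
  have hxy : ‖x * (y : ℂ_[p])⁻¹ - 1‖ < 1 := by
    have hn : ‖x‖ = ‖(y : ℂ_[p])‖ := by
      by_contra hne
      rw [sub_eq_add_neg, IsUltrametricDist.norm_add_eq_max_of_norm_ne_norm
        (by rwa [norm_neg])] at hy
      exact absurd (le_max_left _ _) (not_le.2 hy)
    have e : x * (y : ℂ_[p])⁻¹ - 1 = (x - y) * (y : ℂ_[p])⁻¹ := by field_simp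
    rw [e, norm_mul, norm_inv, ← hn, ← div_eq_mul_inv, div_lt_one (norm_pos_iff.2 hx)]
    exact hy
  obtain ⟨m, s, hm, hs⟩ := exists_norm_pow_eq hy0
  have hpr : (0 : ℝ) < p := by exact_mod_cast hp.out.pos
  have hpn : ‖(p : PadicAlgCl p)‖ = (p : ℝ)⁻¹ := by
    rw [← PadicComplex.norm_extends, PadicComplex.coe_natCast, norm_prime]
  have hu : ‖y ^ m * (p : PadicAlgCl p) ^ s‖ = 1 := by
    rw [norm_mul, norm_pow, hs, norm_zpow, hpn, inv_zpow, mul_inv_cancel₀]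
    exact (zpow_pos hpr s).ne'
  obtain ⟨r, hr, hlt⟩ := exists_pow_sub_one_norm_lt hu
  have hp0 : (p : ℂ_[p]) ≠ 0 := prime_ne_zero
  have hlt' : ‖((y : ℂ_[p]) ^ m * (p : ℂ_[p]) ^ s) ^ r - 1‖ < 1 := by
    rw [← PadicComplex.norm_extends] at hlt
    convert hlt using 2
    simp only [PadicComplex.coe_eq, map_sub, map_pow, map_mul, map_zpow₀, map_natCast, map_one]
  refine ⟨(m * r, -(s * r)), Nat.mul_pos hm hr, ?_⟩
  have e : x ^ (m * r) * (p : ℂ_[p]) ^ (-(-(s * r)))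
      = (x * (y : ℂ_[p])⁻¹) ^ (m * r) * ((y : ℂ_[p]) ^ m * (p : ℂ_[p]) ^ s) ^ r := by
    rw [neg_neg, zpow_mul, zpow_natCast, mul_pow, mul_pow, ← pow_mul, inv_pow]
    field_simp
  change ‖x ^ (m * r) * (p : ℂ_[p]) ^ (-(-(s * r))) - 1‖ < 1
  rw [e]
  exact norm_mul_sub_one_lt (norm_pow_sub_one_lt hxy _) hlt'

theorem logBranch_mul {x y : ℂ_[p]} (hx : x ≠ 0) (hy : y ≠ 0) :
    logBranch 0 (x * y) = logBranch 0 x + logBranch 0 y := by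
  obtain ⟨q, hq⟩ := exists_isLogPair hx
  obtain ⟨q', hq'⟩ := exists_isLogPair hy
  have hp0 : (p : ℂ_[p]) ≠ 0 := prime_ne_zero
  have e : (x * y) ^ (q.1 * q'.1) * (p : ℂ_[p]) ^ (-(q.2 * q'.1 + q'.2 * q.1))
      = (x ^ q.1 * (p : ℂ_[p]) ^ (-q.2)) ^ q'.1 * (y ^ q'.1 * (p : ℂ_[p]) ^ (-q'.2)) ^ q.1 := by
    rw [neg_add, zpow_add₀ hp0, ← neg_mul, ← neg_mul, zpow_mul, zpow_mul, zpow_natCast,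
      zpow_natCast, mul_pow, mul_pow, mul_pow, ← pow_mul, ← pow_mul, mul_comm q'.1 q.1]
    ring_nf
  have h1 := norm_pow_sub_one_lt hq.2 q'.1
  have h2 := norm_pow_sub_one_lt hq'.2 q.1
  have hpair : IsLogPair (x * y) (q.1 * q'.1, q.2 * q'.1 + q'.2 * q.1) := by
    refine ⟨Nat.mul_pos hq.1 hq'.1, ?_⟩
    change ‖(x * y) ^ (q.1 * q'.1) * (p : ℂ_[p]) ^ (-(q.2 * q'.1 + q'.2 * q.1)) - 1‖ < 1
    rw [e]
    exact norm_mul_sub_one_lt h1 h2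
  rw [logBranch_eq hpair, logBranch_eq hq, logBranch_eq hq']
  change logSeries ((x * y) ^ (q.1 * q'.1) * (p : ℂ_[p]) ^ (-(q.2 * q'.1 + q'.2 * q.1)) - 1) /
    ((q.1 * q'.1 : ℕ) : ℂ_[p]) = _
  rw [e, logSeries_mul h1 h2, logSeries_pow hq.2, logSeries_pow hq'.2]
  have c1 : (q.1 : ℂ_[p]) ≠ 0 := by exact_mod_cast hq.1.ne'
  have c2 : (q'.1 : ℂ_[p]) ≠ 0 := by exact_mod_cast hq'.1.ne'
  push_cast
  field_simp

theorem logBranch_eq_logSeries {u : ℂ_[p]} (hu : ‖u - 1‖ < 1) :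
    logBranch 0 u = logSeries (u - 1) := by
  have h : IsLogPair u (1, 0) := ⟨one_pos, by simpa using hu⟩
  rw [logBranch_eq h]
  simp

theorem logBranch_prime : logBranch 0 (p : ℂ_[p]) = 0 := by
  have hp0 : (p : ℂ_[p]) ≠ 0 := prime_ne_zero
  have e : (p : ℂ_[p]) ^ 1 * (p : ℂ_[p]) ^ (-1 : ℤ) = 1 := by
    rw [pow_one, zpow_neg_one, mul_inv_cancel₀ hp0]
  have h : IsLogPair (p : ℂ_[p]) (1, 1) := by
    refine ⟨one_pos, ?_⟩
    change ‖(p : ℂ_[p]) ^ 1 * (p : ℂ_[p]) ^ (-1 : ℤ) - 1‖ < 1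
    rw [e]
    simp
  rw [logBranch_eq h]
  change logSeries ((p : ℂ_[p]) ^ 1 * (p : ℂ_[p]) ^ (-1 : ℤ) - 1) / _ = _
  rw [e, logSeries_one, zero_div]

theorem logBranch_prime_mul {x : ℂ_[p]} (hx : x ≠ 0) :
    logBranch 0 ((p : ℂ_[p]) * x) = logBranch 0 x := by
  rw [logBranch_mul prime_ne_zero hx, logBranch_prime, zero_add]

/-- Near `x`, the function is `log_0 x` plus the logarithmic series at `t/x - 1`. -/
theorem analyticAt_logBranch {x : ℂ_[p]} (hx : x ≠ 0) : AnalyticAt ℂ_[p] (logBranch 0) x := by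
  have h1 : AnalyticAt ℂ_[p] (fun t : ℂ_[p] => logBranch 0 x + logSeries (x⁻¹ * t - 1)) x := by
    refine analyticAt_const.add ?_
    have hl : AnalyticAt ℂ_[p] (fun t : ℂ_[p] => x⁻¹ * t - 1) x := by fun_prop
    refine AnalyticAt.comp_of_eq (g := logSeries) analyticAt_logSeries hl ?_
    rw [inv_mul_cancel₀ hx, sub_self]
  refine h1.congr ?_
  have hev : ∀ᶠ t in 𝓝 x, ‖x⁻¹ * t - 1‖ < 1 := by
    have hc : ContinuousAt (fun t : ℂ_[p] => ‖x⁻¹ * t - 1‖) x := by fun_prop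
    refine hc.eventually_lt continuousAt_const ?_
    rw [inv_mul_cancel₀ hx]
    simp
  filter_upwards [hev] with t ht
  have hu : x⁻¹ * t ≠ 0 := by
    intro h0
    rw [h0] at ht
    simp at ht
  have e : t = x * (x⁻¹ * t) := by rw [mul_inv_cancel_left₀ hx]
  conv_rhs => rw [e]
  rw [logBranch_mul hx hu, logBranch_eq_logSeries ht]

end Logarithm

/-! ### The pairing with Taylor polynomials -/

section Pairing

open Topology Polynomial

variable {p : ℕ} [hp : Fact p.Prime]

/-- The pairing on `P_n` is `(1 / n!) ∑ (-1)^i f⁽ⁱ⁾(x) g⁽ⁿ⁻ⁱ⁾(x)`, for any `x`. -/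
theorem factorial_mul_polyPairing {n : ℕ} {f g : ℂ_[p][X]} (hf : f.natDegree ≤ n)
    (hg : g.natDegree ≤ n) (x : ℂ_[p]) :
    (n.factorial : ℂ_[p]) * polyPairing n f g = ∑ i ∈ Finset.range (n + 1),
      (-1) ^ i * (derivative^[i] f).eval x * (derivative^[n - i] g).eval x := by
  set H : ℂ_[p][X] := ∑ i ∈ Finset.range (n + 1),
    (-1) ^ i * derivative^[i] f * derivative^[n - i] g with hH
  have hH' : ∀ y, H.eval y = ∑ i ∈ Finset.range (n + 1),
      (-1) ^ i * (derivative^[i] f).eval y * (derivative^[n - i] g).eval y := by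
    intro y
    simp [hH, eval_finsetSum]
  -- The derivative telescopes, and its two end terms are derivatives of order `n + 1` of
  -- polynomials of degree at most `n`. So the value may be computed at `0`, where the coefficients
  -- appear.
  have hder : derivative H = 0 := by
    have hterm : ∀ i ∈ Finset.range (n + 1),
        derivative ((-1) ^ i * derivative^[i] f * derivative^[n - i] g)
        = (-1) ^ i * derivative^[i] f * derivative^[n + 1 - i] g
          - (-1) ^ (i + 1) * derivative^[i + 1] f * derivative^[n + 1 - (i + 1)] g := by
      intro i hi
      have hi' : i ≤ n := Nat.lt_succ_iff.1 (Finset.mem_range.1 hi)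
      rw [Nat.succ_sub hi', Nat.succ_sub_succ, Function.iterate_succ_apply',
        Function.iterate_succ_apply', derivative_mul, derivative_mul]
      have h1 : derivative ((-1 : ℂ_[p][X]) ^ i) = 0 := by
        rcases neg_one_pow_eq_or ℂ_[p][X] i with h | h <;> simp [h]
      rw [h1]
      ring
    rw [hH, derivative_sum, Finset.sum_congr rfl hterm,
      Finset.sum_range_sub' (fun i => (-1) ^ i * derivative^[i] f * derivative^[n + 1 - i] g)]
    rw [iterate_derivative_eq_zero (Nat.lt_succ_of_le hf), Nat.sub_zero,
      iterate_derivative_eq_zero (Nat.lt_succ_of_le hg)]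
    simp
  have hconst : H.eval x = H.eval 0 := by
    rw [eq_C_of_natDegree_eq_zero (derivative_eq_zero.1 hder)]
    simp
  rw [← hH' x, hconst, hH' 0, polyPairing, Finset.mul_sum]
  refine Finset.sum_congr rfl fun i hi => ?_
  have hi' : i ≤ n := Nat.lt_succ_iff.1 (Finset.mem_range.1 hi)
  rw [← coeff_zero_eq_eval_zero, ← coeff_zero_eq_eval_zero, coeff_iterate_derivative,
    coeff_iterate_derivative, zero_add, zero_add, Nat.descFactorial_self, Nat.descFactorial_self]
  have hc : (n.choose i : ℂ_[p]) ≠ 0 := by exact_mod_cast (Nat.choose_pos hi').ne'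
  have h := congrArg (Nat.cast (R := ℂ_[p])) (Nat.choose_mul_factorial_mul_factorial hi')
  push_cast at h
  rw [← h]
  simp only [nsmul_eq_mul]
  field_simp

theorem natDegree_taylorPoly_le (n : ℕ) (g : ℂ_[p] → ℂ_[p]) (x : ℂ_[p]) :
    (taylorPoly n g x).natDegree ≤ n := by
  refine natDegree_sum_le_of_forall_le _ _ fun j hj => ?_
  refine (natDegree_C_mul_le _ _).trans ?_
  rw [natDegree_pow, natDegree_X_sub_C, mul_one]
  exact Nat.lt_succ_iff.1 (Finset.mem_range.1 hj)

theorem eval_iterate_derivative_taylorPoly {n i : ℕ} (hi : i ≤ n) (g : ℂ_[p] → ℂ_[p])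
    (x : ℂ_[p]) : (derivative^[i] (taylorPoly n g x)).eval x = iteratedDeriv i g x := by
  rw [taylorPoly, iterate_derivative_sum, eval_finsetSum, Finset.sum_eq_single i]
  · rw [iterate_derivative_C_mul, iterate_derivative_X_sub_pow, Nat.descFactorial_self]
    have : (i.factorial : ℂ_[p]) ≠ 0 := by exact_mod_cast i.factorial_ne_zero
    simp
    field_simp
  · intro j _ hj
    rw [iterate_derivative_C_mul, iterate_derivative_X_sub_pow]
    rcases lt_or_gt_of_ne hj with h | h
    · simp [Nat.descFactorial_of_lt h]
    · have : j - i ≠ 0 := (Nat.sub_pos_of_lt h).ne'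
      simp [this]
  · intro h
    exact absurd (Finset.mem_range.2 (Nat.lt_succ_of_le hi)) h

/-- In this form the pairing involves only the derivatives of `g` at `x`: locality, linearity,
affine covariance and continuity in `x` are all read off from it. -/
theorem factorial_mul_polyPairing_taylorPoly {n : ℕ} {P : ℂ_[p][X]} (hP : P.natDegree ≤ n)
    (g : ℂ_[p] → ℂ_[p]) (x : ℂ_[p]) :
    (n.factorial : ℂ_[p]) * polyPairing n (taylorPoly n g x) P = ∑ i ∈ Finset.range (n + 1),
      (-1) ^ i * iteratedDeriv i g x * (derivative^[n - i] P).eval x := by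
  rw [factorial_mul_polyPairing (natDegree_taylorPoly_le n g x) hP x]
  refine Finset.sum_congr rfl fun i hi => ?_
  rw [eval_iterate_derivative_taylorPoly (Nat.lt_succ_iff.1 (Finset.mem_range.1 hi))]

theorem factorial_cast_ne_zero (n : ℕ) : (n.factorial : ℂ_[p]) ≠ 0 := by
  exact_mod_cast n.factorial_ne_zero

theorem polyPairing_taylorPoly_congr {n : ℕ} {P : ℂ_[p][X]} (hP : P.natDegree ≤ n)
    {f g : ℂ_[p] → ℂ_[p]} {x : ℂ_[p]} (h : f =ᶠ[𝓝 x] g) :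
    polyPairing n (taylorPoly n f x) P = polyPairing n (taylorPoly n g x) P := by
  apply mul_left_cancel₀ (factorial_cast_ne_zero (p := p) n)
  rw [factorial_mul_polyPairing_taylorPoly hP, factorial_mul_polyPairing_taylorPoly hP]
  refine Finset.sum_congr rfl fun i _ => ?_
  rw [h.iteratedDeriv_eq i]

theorem polyPairing_taylorPoly_const_mul {n : ℕ} {P : ℂ_[p][X]} (hP : P.natDegree ≤ n)
    (c : ℂ_[p]) (f : ℂ_[p] → ℂ_[p]) (x : ℂ_[p]) :
    polyPairing n (taylorPoly n (fun t => c * f t) x) P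
      = c * polyPairing n (taylorPoly n f x) P := by
  apply mul_left_cancel₀ (factorial_cast_ne_zero (p := p) n)
  rw [mul_left_comm, factorial_mul_polyPairing_taylorPoly hP,
    factorial_mul_polyPairing_taylorPoly hP, Finset.mul_sum]
  refine Finset.sum_congr rfl fun i _ => ?_
  rw [iteratedDeriv_const_mul_field]
  ring

theorem polyPairing_taylorPoly_add {n : ℕ} {P : ℂ_[p][X]} (hP : P.natDegree ≤ n)
    {f g : ℂ_[p] → ℂ_[p]} {x : ℂ_[p]} (hf : AnalyticAt ℂ_[p] f x) (hg : AnalyticAt ℂ_[p] g x) :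
    polyPairing n (taylorPoly n (fun t => f t + g t) x) P
      = polyPairing n (taylorPoly n f x) P + polyPairing n (taylorPoly n g x) P := by
  apply mul_left_cancel₀ (factorial_cast_ne_zero (p := p) n)
  rw [mul_add, factorial_mul_polyPairing_taylorPoly hP, factorial_mul_polyPairing_taylorPoly hP,
    factorial_mul_polyPairing_taylorPoly hP, ← Finset.sum_add_distrib]
  refine Finset.sum_congr rfl fun i _ => ?_
  rw [iteratedDeriv_fun_add hf.contDiffAt hg.contDiffAt]
  ring

theorem polyPairing_taylorPoly_sum {n : ℕ} {P : ℂ_[p][X]} (hP : P.natDegree ≤ n)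
    {ι : Type*} (s : Finset ι) {f : ι → ℂ_[p] → ℂ_[p]} {x : ℂ_[p]}
    (hf : ∀ i ∈ s, AnalyticAt ℂ_[p] (f i) x) :
    polyPairing n (taylorPoly n (fun t => ∑ i ∈ s, f i t) x) P
      = ∑ i ∈ s, polyPairing n (taylorPoly n (f i) x) P := by
  classical
  induction s using Finset.induction_on with
  | empty =>
    have h := polyPairing_taylorPoly_const_mul hP 0 (fun _ => (0 : ℂ_[p])) x
    simpa using h
  | insert i s hi ih =>
    simp only [Finset.sum_insert hi]
    rw [polyPairing_taylorPoly_add hP (hf i (Finset.mem_insert_self i s)), ih]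
    · exact fun j hj => hf j (Finset.mem_insert_of_mem hj)
    · exact Finset.analyticAt_fun_sum _ fun j hj => hf j (Finset.mem_insert_of_mem hj)

theorem iteratedDeriv_comp_affine (G : ℂ_[p] → ℂ_[p]) (q a : ℂ_[p]) (i : ℕ) :
    iteratedDeriv i (fun t => G (q * t + a)) = fun t => q ^ i * iteratedDeriv i G (q * t + a) := by
  induction i with
  | zero => simp
  | succ i ih =>
    rw [iteratedDeriv_succ, ih]
    funext t
    have h := deriv_comp_mul_left q (fun s => iteratedDeriv i G (s + a)) t
    rw [deriv_const_mul_field, h, deriv_comp_add_const, ← iteratedDeriv_succ, pow_succ, smul_eq_mul]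
    ring

theorem iterate_derivative_comp_affine (Q : ℂ_[p][X]) (q a : ℂ_[p]) (j : ℕ) :
    derivative^[j] (Q.comp (C q * X + C a)) = C (q ^ j) * (derivative^[j] Q).comp (C q * X + C a) := by
  induction j with
  | zero => simp
  | succ j ih =>
    rw [Function.iterate_succ_apply', ih, derivative_C_mul, derivative_comp,
      Function.iterate_succ_apply', pow_succ, C_mul]
    simp
    ring

/-- Covariance of the pairing under an affine substitution. -/
theorem polyPairing_taylorPoly_affine {n : ℕ} {P Q : ℂ_[p][X]} (hP : P.natDegree ≤ n)
    (hQ : Q.natDegree ≤ n) {q a c : ℂ_[p]} (h : Q.comp (C q * X + C a) = C c * P)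
    (G : ℂ_[p] → ℂ_[p]) (x : ℂ_[p]) :
    q ^ n * polyPairing n (taylorPoly n G (q * x + a)) Q
      = c * polyPairing n (taylorPoly n (fun t => G (q * t + a)) x) P := by
  apply mul_left_cancel₀ (factorial_cast_ne_zero (p := p) n)
  rw [mul_left_comm, factorial_mul_polyPairing_taylorPoly hQ, mul_left_comm,
    factorial_mul_polyPairing_taylorPoly hP, Finset.mul_sum, Finset.mul_sum]
  refine Finset.sum_congr rfl fun i hi => ?_
  have hi' : i ≤ n := Nat.lt_succ_iff.1 (Finset.mem_range.1 hi)
  have h1 := congrArg (fun R : ℂ_[p][X] => (derivative^[n - i] R).eval x) h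
  simp only [iterate_derivative_comp_affine, iterate_derivative_C_mul, eval_mul, eval_C, eval_comp,
    eval_add, eval_X] at h1
  rw [iteratedDeriv_comp_affine]
  have h2 : q ^ n = q ^ i * q ^ (n - i) := by rw [← pow_add, Nat.add_sub_cancel' hi']
  rw [h2]
  linear_combination ((-1) ^ i * q ^ i * iteratedDeriv i G (q * x + a)) * h1

theorem continuousAt_polyPairing_taylorPoly {n : ℕ} {P : ℂ_[p][X]} (hP : P.natDegree ≤ n)
    {g : ℂ_[p] → ℂ_[p]} {x : ℂ_[p]} (hg : AnalyticAt ℂ_[p] g x) :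
    ContinuousAt (fun y => polyPairing n (taylorPoly n g y) P) x := by
  have e : (fun y => polyPairing n (taylorPoly n g y) P) = fun y =>
      (n.factorial : ℂ_[p])⁻¹ * ∑ i ∈ Finset.range (n + 1),
        (-1) ^ i * iteratedDeriv i g y * (derivative^[n - i] P).eval y := by
    funext y
    rw [← factorial_mul_polyPairing_taylorPoly hP, inv_mul_cancel_left₀ (factorial_cast_ne_zero n)]
  rw [e]
  refine continuousAt_const.mul (tendsto_finsetSum _ fun i _ => ?_)
  have h1 : ContinuousAt (iteratedDeriv i g) x := by
    rw [iteratedDeriv_eq_iterate]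
    exact (hg.iterated_deriv i).continuousAt
  exact (continuousAt_const.mul h1).mul (Polynomial.continuous _).continuousAt

theorem polyPairing_sum_right (n : ℕ) (f : ℂ_[p][X]) {ι : Type*} (s : Finset ι)
    (g : ι → ℂ_[p][X]) : polyPairing n f (∑ i ∈ s, g i) = ∑ i ∈ s, polyPairing n f (g i) := by
  simp only [polyPairing, finsetSum_coeff, Finset.mul_sum]
  exact Finset.sum_comm

theorem polyPairing_zero_right (n : ℕ) (f : ℂ_[p][X]) : polyPairing n f 0 = 0 := by
  simp [polyPairing]

theorem polyPairing_zsmul_right (n : ℕ) (f g : ℂ_[p][X]) (m : ℤ) :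
    polyPairing n f (m • g) = m * polyPairing n f g := by
  simp only [polyPairing, coeff_smul, Finset.mul_sum]
  refine Finset.sum_congr rfl fun i _ => ?_
  rw [zsmul_eq_mul]
  ring

end Pairing

/-! ### Integration against finitely supported measures -/

section Integration

open Topology Polynomial

variable {p : ℕ} [hp : Fact p.Prime]

variable (p) in
/-- The disk of radius `p^{-N}` of `K` around `x`. -/
def diskAt (N : ℕ) (x : ℂ_[p]) : Set ℂ_[p] :=
  {t | t ∈ unramK p ∧ ‖t - x‖ ≤ (p : ℝ) ^ (-(N : ℤ))}

theorem mem_diskAt_self {N : ℕ} {x : ℂ_[p]} (hx : x ∈ unramK p) : x ∈ diskAt p N x :=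
  ⟨hx, by simp⟩

/-- By the ultrametric inequality every point of a disk is a centre. -/
theorem eq_diskAt_of_mem {N : ℕ} {x : ℂ_[p]} {U : Set ℂ_[p]} (hU : U ∈ disks p N) (hx : x ∈ U) :
    U = diskAt p N x := by
  obtain ⟨y, -, rfl⟩ := hU
  have hxy := hx.2
  ext t
  refine and_congr_right fun _ => ⟨fun h => ?_, fun h => ?_⟩
  · have e : t - x = (t - y) - (x - y) := by ring
    rw [e, sub_eq_add_neg]
    exact (IsUltrametricDist.norm_add_le_max _ _).trans (max_le h (by rwa [norm_neg]))
  · have e : t - y = (t - x) + (x - y) := by ring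
    rw [e]
    exact (IsUltrametricDist.norm_add_le_max _ _).trans (max_le h hxy)

open Classical in
/-- The integral of a locally analytic function against a sum of polynomial-valued Dirac measures
is the sum of the pairings with the Taylor polynomials at the points of the support. -/
theorem integral_eq_sum {n : ℕ} {ι : Type*} (s : Finset ι) {x : ι → ℂ_[p]} {P : ι → ℂ_[p][X]}
    (hx : ∀ i ∈ s, x i ∈ unramK p) (hP : ∀ i ∈ s, (P i).natDegree ≤ n)
    {μ : Set ℂ_[p] → ℂ_[p][X]}
    (hμ : ∀ N, ∀ U ∈ disks p N, μ U = ∑ i ∈ s, if x i ∈ U then P i else 0)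
    {g : ℂ_[p] → ℂ_[p]} (hg : ∀ i ∈ s, AnalyticAt ℂ_[p] g (x i)) :
    integral n μ g = ∑ i ∈ s, polyPairing n (taylorPoly n g (x i)) (P i) := by
  let c : ℕ → ι → ℂ_[p] := fun N i => Classical.epsilon fun y => y ∈ diskAt p N (x i)
  have hc : ∀ N, ∀ i ∈ s, c N i ∈ diskAt p N (x i) := fun N i hi =>
    Classical.epsilon_spec (p := fun y => y ∈ diskAt p N (x i)) ⟨x i, mem_diskAt_self (hx i hi)⟩
  have hsum : ∀ N : ℕ, ∑ᶠ U ∈ disks p N,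
      polyPairing n (taylorPoly n g (Classical.epsilon fun y => y ∈ U)) (μ U)
      = ∑ i ∈ s, polyPairing n (taylorPoly n g (c N i)) (P i) := by
    intro N
    -- Only the disks that contain a point of the support contribute to the sum.
    let T : Finset (Set ℂ_[p]) := s.image fun i => diskAt p N (x i)
    have hT : ∀ U ∈ T, U ∈ disks p N := by
      intro U hU
      obtain ⟨i, hi, rfl⟩ := Finset.mem_image.1 hU
      exact ⟨x i, hx i hi, rfl⟩
    have hμ' : ∀ U ∈ disks p N,
        polyPairing n (taylorPoly n g (Classical.epsilon fun y => y ∈ U)) (μ U)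
        = ∑ i ∈ s, if x i ∈ U then
          polyPairing n (taylorPoly n g (Classical.epsilon fun y => y ∈ U)) (P i) else 0 := by
      intro U hU
      rw [hμ N U hU, polyPairing_sum_right]
      refine Finset.sum_congr rfl fun i _ => ?_
      split_ifs
      · rfl
      · exact polyPairing_zero_right _ _
    rw [finsum_mem_eq_sum_of_inter_support_eq (t := T),
      Finset.sum_congr rfl fun U hU => hμ' U (hT U hU), Finset.sum_comm]
    · refine Finset.sum_congr rfl fun i hi => ?_
      rw [Finset.sum_eq_single (diskAt p N (x i)), if_pos (mem_diskAt_self (hx i hi))]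
      · intro U hU hne
        exact if_neg fun hmem => hne (eq_diskAt_of_mem (hT U hU) hmem)
      · intro h
        exact absurd (Finset.mem_image_of_mem _ hi) h
    · ext U
      refine and_congr_left fun hsupp => ⟨fun hU => ?_, fun hU => hT U hU⟩
      rw [Function.mem_support, hμ' U hU] at hsupp
      obtain ⟨i, hi, hne⟩ := Finset.exists_ne_zero_of_sum_ne_zero hsupp
      have hmem : x i ∈ U := by
        by_contra h
        exact hne (if_neg h)
      exact Finset.mem_image.2 ⟨i, hi, (eq_diskAt_of_mem hU hmem).symm⟩
  rw [integral]
  simp_rw [hsum]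
  -- The selected point of the disk is within `p^{-N}` of `x i`, so continuity of the pairing in the
  -- centre gives the limit.
  refine Tendsto.limUnder_eq (tendsto_finsetSum _ fun i hi => ?_)
  have hci : Tendsto (fun N => c N i) atTop (𝓝 (x i)) := by
    rw [tendsto_iff_norm_sub_tendsto_zero]
    have hz : Tendsto (fun N : ℕ => (p : ℝ) ^ (-(N : ℤ))) atTop (𝓝 0) := by
      have h := tendsto_pow_atTop_nhds_zero_of_lt_one (r := (p : ℝ)⁻¹) (by positivity)
        (inv_lt_one_of_one_lt₀ (by exact_mod_cast hp.out.one_lt))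
      simpa [zpow_neg] using h
    exact squeeze_zero (fun _ => norm_nonneg _) (fun N => (hc N i hi).2) hz
  exact (continuousAt_polyPairing_taylorPoly (hP i hi) (hg i hi)).tendsto.comp hci

end Integration

/-! ### The logarithmic kernel -/

section Kernel

open Topology

variable {p : ℕ} [hp : Fact p.Prime]

theorem eventually_norm_le_one {x : ℂ_[p]} (hx : ‖x‖ ≤ 1) : ∀ᶠ t in 𝓝 x, ‖t‖ ≤ 1 := by
  filter_upwards [Metric.ball_mem_nhds x one_pos] with t ht
  rw [mem_ball_iff_norm] at ht
  have e : t = (t - x) + x := by ring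
  rw [e]
  exact (IsUltrametricDist.norm_add_le_max _ _).trans (max_le ht.le hx)

theorem logKernel_eventuallyEq_of_norm_le (n : ℕ) (z : ℂ_[p]) {x : ℂ_[p]} (hx : ‖x‖ ≤ 1) :
    logKernel n z =ᶠ[𝓝 x] fun t => (t - z) ^ n * logBranch 0 (t - z) := by
  filter_upwards [eventually_norm_le_one hx] with t ht
  rw [logKernel, if_pos ht]

theorem logKernel_eventuallyEq_of_lt_norm (n : ℕ) (z : ℂ_[p]) {x : ℂ_[p]} (hx : 1 < ‖x‖) :
    logKernel n z =ᶠ[𝓝 x] fun t => (t - z) ^ n * logBranch 0 (1 - z / t) := by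
  filter_upwards [continuous_norm.continuousAt.eventually_const_lt hx] with t ht
  rw [logKernel, if_neg (not_le.2 ht)]

/-- Both `|t| ≤ 1` and `|t| > 1` are open conditions, so a single formula holds near `x`; in each
the argument of the logarithm vanishes only at `t = z`. -/
theorem analyticAt_logKernel (n : ℕ) {z x : ℂ_[p]} (h : x ≠ z) :
    AnalyticAt ℂ_[p] (logKernel n z) x := by
  have hpow : AnalyticAt ℂ_[p] (fun t : ℂ_[p] => (t - z) ^ n) x := by fun_prop
  rcases le_or_gt ‖x‖ 1 with hx | hx
  · refine AnalyticAt.congr (hpow.mul ?_) (logKernel_eventuallyEq_of_norm_le n z hx).symm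
    exact AnalyticAt.comp (g := logBranch 0) (analyticAt_logBranch (sub_ne_zero.2 h))
      (by fun_prop)
  · have hx0 : x ≠ 0 := by
      rintro rfl
      simp at hx
      linarith
    refine AnalyticAt.congr (hpow.mul ?_) (logKernel_eventuallyEq_of_lt_norm n z hx).symm
    refine AnalyticAt.comp (g := logBranch 0) (f := fun t => 1 - z / t)
      (analyticAt_logBranch ?_) ?_
    · rw [Ne, sub_eq_zero, eq_div_iff hx0, one_mul]
      exact h
    · exact analyticAt_const.sub (analyticAt_const.div analyticAt_id hx0)

end Kernel

/-! ### The primitive as a finite sum -/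

section Primitive

variable {p : ℕ} [hp : Fact p.Prime] {ιinf : Qbar →+* ℂ} {ιp : Qbar →+* ℂ_[p]}

/-- The points of `K` which contribute to the truncated measure `Φ_{k,D,l}^{(a)}{r,s}`. -/
def truncSupport (D : RMDivisor p ιinf ιp) (l : ℕ) (a : OnePoint (ZMod p)) (r s : OnePoint ℚ) :
    Set (RMPoint p ιinf ιp) :=
  {w | D w.orbit ≠ 0 ∧ w.inter r s ≠ 0 ∧ ιp w ∈ unramK p ∧ HasLevel (ιp w) l ∧ Reduces (ιp w) a}

/-- The pairing of `P_w` with the Taylor polynomial of `g` at `w`. -/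
def pointPairing (n : ℕ) (g : ℂ_[p] → ℂ_[p]) (w : RMPoint p ιinf ιp) : ℂ_[p] :=
  polyPairing n (taylorPoly n g (ιp w)) (w.poly n)

theorem natDegree_poly_le (n : ℕ) (w : RMPoint p ιinf ιp) : (w.poly n).natDegree ≤ n := by
  refine (Polynomial.natDegree_C_mul_le _ _).trans (Polynomial.natDegree_mul_le.trans ?_)
  rw [Polynomial.natDegree_pow, Polynomial.natDegree_pow, Polynomial.natDegree_X_sub_C,
    Polynomial.natDegree_X_sub_C]
  omega

open Classical in
theorem Phi_eq_sum (k : ℕ) (D : RMDivisor p ιinf ιp) (l : ℕ) (a : OnePoint (ZMod p))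
    (r s : OnePoint ℚ) (hfin : (truncSupport D l a r s).Finite) {U : Set ℂ_[p]}
    (hU : U ⊆ unramK p) :
    Phi k D l a r s U = ∑ w ∈ hfin.toFinset, if ιp w ∈ U then
      (D w.orbit * w.inter r s) • w.poly (k - 2) else 0 := by
  have h1 : ∀ o ∈ D.support, D o • ∑ᶠ (w : RMPoint p ιinf ιp)
      (_ : w ∈ o.sigma r s ∧ ιp w ∈ U ∧ HasLevel (ιp w) l ∧ Reduces (ιp w) a),
      w.inter r s • w.poly (k - 2)
      = ∑ w ∈ hfin.toFinset, if w.orbit = o then (if ιp w ∈ U then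
        (D w.orbit * w.inter r s) • w.poly (k - 2) else 0) else 0 := by
    intro o ho
    have ho' : D o ≠ 0 := Finsupp.mem_support_iff.1 ho
    have hset : {w : RMPoint p ιinf ιp | w ∈ o.sigma r s ∧ ιp w ∈ U ∧ HasLevel (ιp w) l ∧
        Reduces (ιp w) a} = ((hfin.toFinset.filter fun w => w.orbit = o ∧ ιp w ∈ U :
          Finset (RMPoint p ιinf ιp)) : Set (RMPoint p ιinf ιp)) := by
      ext w
      simp only [RMOrbit.sigma, Set.mem_ofPred_eq, Finset.coe_filter, Set.Finite.mem_toFinset,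
        truncSupport]
      constructor
      · rintro ⟨⟨h1, h2⟩, h3, h4, h5⟩
        exact ⟨⟨by rwa [h1], h2, hU h3, h4, h5⟩, h1, h3⟩
      · rintro ⟨⟨-, h2, -, h4, h5⟩, h1, h3⟩
        exact ⟨⟨h1, h2⟩, h3, h4, h5⟩
    change D o • (∑ᶠ w ∈ {w : RMPoint p ιinf ιp | w ∈ o.sigma r s ∧ ιp w ∈ U ∧
      HasLevel (ιp w) l ∧ Reduces (ιp w) a}, w.inter r s • w.poly (k - 2)) = _
    rw [hset, finsum_mem_coe_finset, Finset.sum_filter, Finset.smul_sum]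
    refine Finset.sum_congr rfl fun w _ => ?_
    by_cases h : w.orbit = o
    · by_cases h' : ιp w ∈ U
      · rw [if_pos ⟨h, h'⟩, if_pos h, if_pos h', h, mul_smul]
      · rw [if_neg fun h0 => h' h0.2, if_pos h, if_neg h', smul_zero]
    · rw [if_neg fun h0 => h h0.1, if_neg h, smul_zero]
  rw [Phi, Finsupp.sum, Finset.sum_congr rfl h1, Finset.sum_comm]
  refine Finset.sum_congr rfl fun w hw => ?_
  rw [Finset.sum_ite_eq, if_pos]
  exact Finsupp.mem_support_iff.2 (hfin.mem_toFinset.1 hw).1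

/-- Finiteness is a hypothesis here because for the path from `-a/p` to `∞` it will be obtained by
transport from the path from `0` to `∞`. -/
theorem F_eq_finsum (k : ℕ) (D : RMDivisor p ιinf ιp) (l : ℕ) (a : OnePoint (ZMod p))
    (r s : OnePoint ℚ) (hfin : (truncSupport D (l + 1) a r s).Finite) {z : ℂ_[p]}
    (hz : z ∉ unramK p) :
    F k D l a r s z = ∑ᶠ w ∈ truncSupport D (l + 1) a r s,
      ((D w.orbit * w.inter r s : ℤ) : ℂ_[p]) *
        pointPairing (k - 2) (logKernel (k - 2) z) w := by
  classical
  rw [F, integral_eq_sum hfin.toFinset (x := fun w => ιp w)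
    (P := fun w => (D w.orbit * w.inter r s) • w.poly (k - 2)), finsum_mem_eq_finite_toFinset_sum _ hfin]
  · exact Finset.sum_congr rfl fun w _ => polyPairing_zsmul_right _ _ _ _
  · exact fun w hw => (hfin.mem_toFinset.1 hw).2.2.1
  · exact fun w _ => (Polynomial.natDegree_smul_le _ _).trans (natDegree_poly_le _ w)
  · rintro N U ⟨x, -, rfl⟩
    exact Phi_eq_sum k D (l + 1) a r s hfin fun t ht => ht.1
  · intro w hw
    refine analyticAt_logKernel _ fun h => hz ?_
    rw [← h]
    exact (hfin.mem_toFinset.1 hw).2.2.1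

end Primitive

/-! ### Levels and reductions -/

section Level

variable {p : ℕ} [hp : Fact p.Prime]

theorem zpow_neg_lt_one {l : ℕ} (hl : l ≠ 0) : (p : ℝ) ^ (-(l : ℤ)) < 1 := by
  rw [zpow_neg, zpow_natCast]
  exact inv_lt_one_of_one_lt₀ (one_lt_pow₀ (by exact_mod_cast hp.out.one_lt) hl)

theorem norm_sub_eq_right {x y : ℂ_[p]} (h : ‖x‖ < ‖y‖) : ‖x - y‖ = ‖y‖ := by
  rw [sub_eq_add_neg, IsUltrametricDist.norm_add_eq_max_of_norm_ne_norm
    (by rw [norm_neg]; exact h.ne), norm_neg, max_eq_right h.le]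

theorem norm_le_one_of_norm_sub_lt {x y : ℂ_[p]} (hx : ‖x‖ ≤ 1) (h : ‖x - y‖ < 1) : ‖y‖ ≤ 1 := by
  by_contra hy
  rw [norm_sub_eq_right (hx.trans_lt (not_le.1 hy))] at h
  exact hy h.le

/-- The level of an integral point is determined by its distances to the points of `ℚ_p`. -/
theorem hasLevel_iff_of_norm_le_one {x : ℂ_[p]} (hx : ‖x‖ ≤ 1) {l : ℕ} (hl : l ≠ 0) :
    HasLevel x l ↔ (∃ y : ℚ_[p], ‖x - algebraMap ℚ_[p] ℂ_[p] y‖ = (p : ℝ) ^ (-(l : ℤ))) ∧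
      ∀ y : ℚ_[p], (p : ℝ) ^ (-(l : ℤ)) ≤ ‖x - algebraMap ℚ_[p] ℂ_[p] y‖ := by
  have hlt := zpow_neg_lt_one (p := p) hl
  have hinf : chordal x ∞ = 1 := by simp [chordal, hx]
  have hsmall : ∀ y : ℚ_[p], ‖y‖ ≤ 1 → chordal x y = ‖x - algebraMap ℚ_[p] ℂ_[p] y‖ := by
    intro y hy
    simp only [chordal]
    rw [max_eq_left hx, max_eq_left hy]
    simp
  -- Points of `ℙ¹(ℚ_p)` outside the unit disk are at chordal distance `1`, so they cannot realise a
  -- positive level.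
  have hlarge : ∀ y : ℚ_[p], 1 < ‖y‖ → chordal x y = 1 ∧ 1 ≤ ‖x - algebraMap ℚ_[p] ℂ_[p] y‖ := by
    intro y hy
    have h : ‖x - algebraMap ℚ_[p] ℂ_[p] y‖ = ‖y‖ := by
      rw [norm_sub_eq_right, norm_algebraMap_padic]
      rw [norm_algebraMap_padic]
      exact hx.trans_lt hy
    simp only [chordal]
    rw [h, max_eq_left hx, max_eq_right hy.le, one_mul, div_self (by linarith)]
    exact ⟨rfl, hy.le⟩
  constructor
  · rintro ⟨⟨y, hy⟩, hmin⟩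
    refine ⟨?_, fun y => ?_⟩
    · induction y using OnePoint.rec with
      | infty => rw [hinf] at hy; linarith
      | coe y =>
        rcases le_or_gt ‖y‖ 1 with h | h
        · exact ⟨y, by rw [← hsmall y h]; exact hy⟩
        · have := (hlarge y h).1
          rw [hy] at this
          linarith
    · rcases le_or_gt ‖y‖ 1 with h | h
      · rw [← hsmall y h]
        exact hmin ⟨_, rfl⟩
      · exact hlt.le.trans (hlarge y h).2
  · rintro ⟨⟨y, hy⟩, hmin⟩
    refine ⟨⟨(y : OnePoint ℚ_[p]), ?_⟩, ?_⟩
    · rw [hsmall y, hy]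
      rw [← norm_algebraMap_padic (p := p)]
      exact norm_le_one_of_norm_sub_lt hx (by rwa [hy])
    · rintro _ ⟨y, rfl⟩
      induction y using OnePoint.rec with
      | infty => rw [hinf]; exact hlt.le
      | coe y =>
        rcases le_or_gt ‖y‖ 1 with h | h
        · rw [hsmall y h]
          exact hmin y
        · rw [(hlarge y h).1]
          exact hlt.le

theorem norm_lt_one_iff_padic {y : ℚ_[p]} : ‖y‖ < 1 ↔ ‖y‖ ≤ (p : ℝ)⁻¹ := by
  have h := Padic.norm_le_pow_iff_norm_lt_pow_add_one y (-1)
  simpa using h.symm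

theorem norm_intCast_sub_val_lt (a : ℤ) :
    ‖(a : ℂ_[p]) - (((a : ZMod p).val : ℕ) : ℂ_[p])‖ < 1 := by
  have h : (p : ℤ) ∣ a - ((a : ZMod p).val : ℤ) := by
    rw [← ZMod.intCast_zmod_eq_zero_iff_dvd]
    simp
  have h' := (Padic.norm_intCast_lt_one_iff (p := p)).2 h
  rw [← norm_algebraMap_padic] at h'
  simpa only [Int.cast_sub, Int.cast_natCast, map_sub, map_natCast, map_intCast] using h'

theorem norm_intCast_le_one (a : ℤ) : ‖(a : ℂ_[p])‖ ≤ 1 := by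
  rw [← map_intCast (algebraMap ℚ_[p] ℂ_[p]), norm_algebraMap_padic]
  exact Padic.norm_int_le_one a

theorem norm_prime_mul (x : ℂ_[p]) : ‖(p : ℂ_[p]) * x‖ = (p : ℝ)⁻¹ * ‖x‖ := by
  rw [norm_mul, norm_prime]

theorem one_lt_prime_real : (1 : ℝ) < p := by exact_mod_cast hp.out.one_lt

theorem zpow_neg_succ (l : ℕ) :
    (p : ℝ) ^ (-((l + 1 : ℕ) : ℤ)) = (p : ℝ)⁻¹ * (p : ℝ) ^ (-(l : ℤ)) := by
  have := one_lt_prime_real (p := p)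
  rw [← zpow_neg_one, ← zpow_add₀ (by linarith)]
  congr 1
  push_cast
  ring

/-- The map `x ↦ p x + a` sends the integral points of level `l` to the points of level `l + 1`
which are congruent to `a`. -/
theorem hasLevel_affine_iff (a : ℤ) {x : ℂ_[p]} {l : ℕ} (hl : l ≠ 0) :
    (‖x‖ ≤ 1 ∧ HasLevel x l) ↔
      HasLevel ((p : ℂ_[p]) * x + (a : ℂ_[p])) (l + 1) ∧ ‖(p : ℂ_[p]) * x + a - a‖ < 1 := by
  have hp1 := one_lt_prime_real (p := p)
  have hpinv : (p : ℝ)⁻¹ < 1 := inv_lt_one_of_one_lt₀ hp1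
  have hpinv0 : 0 < (p : ℝ)⁻¹ := by positivity
  have hp0 : (p : ℚ_[p]) ≠ 0 := by exact_mod_cast hp.out.ne_zero
  have hdist : ∀ y : ℚ_[p], ‖(p : ℂ_[p]) * x + a - algebraMap ℚ_[p] ℂ_[p] (p * y + a)‖
      = (p : ℝ)⁻¹ * ‖x - algebraMap ℚ_[p] ℂ_[p] y‖ := by
    intro y
    rw [← norm_prime_mul]
    congr 1
    simp only [map_add, map_mul, map_natCast, map_intCast]
    ring
  have hsurj : ∀ y : ℚ_[p], ∃ y' : ℚ_[p], y = p * y' + a := fun y =>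
    ⟨(y - a) / p, by field_simp; ring⟩
  have hx1 : ‖(p : ℂ_[p]) * x‖ < 1 → ‖(p : ℂ_[p]) * x + a‖ ≤ 1 := fun h =>
    (IsUltrametricDist.norm_add_le_max _ _).trans (max_le h.le (norm_intCast_le_one a))
  have hequiv : ‖x‖ ≤ 1 → ‖(p : ℂ_[p]) * x‖ < 1 →
      (HasLevel x l ↔ HasLevel ((p : ℂ_[p]) * x + (a : ℂ_[p])) (l + 1)) := by
    intro h h'
    rw [hasLevel_iff_of_norm_le_one h hl, hasLevel_iff_of_norm_le_one (hx1 h') l.succ_ne_zero,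
      zpow_neg_succ]
    refine and_congr ⟨?_, ?_⟩ ⟨?_, ?_⟩
    · rintro ⟨y, hy⟩
      exact ⟨p * y + a, by rw [hdist, hy]⟩
    · rintro ⟨y, hy⟩
      obtain ⟨y', rfl⟩ := hsurj y
      rw [hdist] at hy
      exact ⟨y', mul_left_cancel₀ hpinv0.ne' hy⟩
    · intro hall y
      obtain ⟨y', rfl⟩ := hsurj y
      rw [hdist]
      exact mul_le_mul_of_nonneg_left (hall y') hpinv0.le
    · intro hall y
      have h := hall (p * y + a)
      rw [hdist] at h
      exact le_of_mul_le_mul_left h hpinv0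
  rw [add_sub_cancel_right]
  constructor
  · rintro ⟨h, hlev⟩
    have h' : ‖(p : ℂ_[p]) * x‖ < 1 := by
      rw [norm_prime_mul]
      nlinarith
    exact ⟨(hequiv h h').1 hlev, h'⟩
  · rintro ⟨hlev, h'⟩
    -- A priori the norm of `x` may lie strictly between `1` and `p`. The level puts a point of
    -- `ℚ_p` at distance less than `1`; if `|x| > 1` the two norms agree, and the discreteness of
    -- the norms of `ℚ_p` gives a contradiction.
    have h : ‖x‖ ≤ 1 := by
      obtain ⟨⟨y, hy⟩, -⟩ := (hasLevel_iff_of_norm_le_one (hx1 h') l.succ_ne_zero).1 hlev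
      obtain ⟨y', rfl⟩ := hsurj y
      rw [hdist, zpow_neg_succ] at hy
      have hxy : ‖x - algebraMap ℚ_[p] ℂ_[p] y'‖ < 1 := by
        rw [mul_left_cancel₀ hpinv0.ne' hy]
        exact zpow_neg_lt_one hl
      by_contra hx
      have hy1 : ‖x‖ = ‖algebraMap ℚ_[p] ℂ_[p] y'‖ := by
        by_contra hne
        rw [sub_eq_add_neg, IsUltrametricDist.norm_add_eq_max_of_norm_ne_norm
          (by rwa [norm_neg])] at hxy
        exact hx ((le_max_left _ _).trans hxy.le)
      have h3 : ‖(p : ℚ_[p]) * y'‖ < 1 := by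
        rw [norm_mul, Padic.norm_p, ← norm_algebraMap_padic y', ← hy1, ← norm_prime_mul]
        exact h'
      rw [norm_lt_one_iff_padic, norm_mul, Padic.norm_p, ← norm_algebraMap_padic y', ← hy1] at h3
      apply hx
      have := le_of_mul_le_mul_left (h3.trans_eq (mul_one _).symm) hpinv0
      exact this
    exact ⟨h, (hequiv h h').2 hlev⟩

theorem reduces_intCast_iff (a : ℤ) (x : ℂ_[p]) :
    Reduces x ((a : ZMod p) : OnePoint (ZMod p)) ↔ ‖x - a‖ < 1 := by
  have h := norm_intCast_sub_val_lt (p := p) a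
  change ‖x - (((a : ZMod p).val : ℕ) : ℂ_[p])‖ < 1 ↔ _
  constructor
  · intro h1
    have e : x - a = (x - (((a : ZMod p).val : ℕ) : ℂ_[p])) +
        -((a : ℂ_[p]) - (((a : ZMod p).val : ℕ) : ℂ_[p])) := by ring
    rw [e]
    exact (IsUltrametricDist.norm_add_le_max _ _).trans_lt (max_lt h1 (by rwa [norm_neg]))
  · intro h1
    have e : x - (((a : ZMod p).val : ℕ) : ℂ_[p]) = (x - a) +
        ((a : ℂ_[p]) - (((a : ZMod p).val : ℕ) : ℂ_[p])) := by ring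
    rw [e]
    exact (IsUltrametricDist.norm_add_le_max _ _).trans_lt (max_lt h1 h)

theorem norm_le_one_of_reduces {x : ℂ_[p]} {b : ZMod p} (h : Reduces x b) : ‖x‖ ≤ 1 := by
  have h' : ‖x - (b.val : ℂ_[p])‖ < 1 := h
  have e : x = (x - (b.val : ℂ_[p])) + (b.val : ℂ_[p]) := by ring
  rw [e]
  exact (IsUltrametricDist.norm_add_le_max _ _).trans
    (max_le h'.le (IsUltrametricDist.norm_natCast_le_one _ _))

/-- Positive level means that `x` is congruent to a point of `ℤ_p`, which has a residue in `𝔽_p`. -/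
theorem exists_reduces {x : ℂ_[p]} (hx : ‖x‖ ≤ 1) {l : ℕ} (hl : l ≠ 0) (h : HasLevel x l) :
    ∃ b : ZMod p, Reduces x b := by
  obtain ⟨⟨y, hy⟩, -⟩ := (hasLevel_iff_of_norm_le_one hx hl).1 h
  have hlt : ‖x - algebraMap ℚ_[p] ℂ_[p] y‖ < 1 := by
    rw [hy]
    exact zpow_neg_lt_one hl
  have hy1 : ‖y‖ ≤ 1 := by
    rw [← norm_algebraMap_padic]
    exact norm_le_one_of_norm_sub_lt hx hlt
  obtain ⟨Y, rfl⟩ : ∃ Y : ℤ_[p], (Y : ℚ_[p]) = y := ⟨⟨y, hy1⟩, rfl⟩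
  obtain ⟨m, -, hm⟩ := PadicInt.exists_mem_range (p := p) Y
  have hm' : ‖algebraMap ℚ_[p] ℂ_[p] Y - (m : ℤ)‖ < 1 := by
    have h1 : ‖(Y : ℚ_[p]) - m‖ < 1 := by
      have := PadicInt.mem_nonunits.1 ((IsLocalRing.mem_maximalIdeal _).1 hm)
      rw [PadicInt.norm_def, PadicInt.coe_sub, PadicInt.coe_natCast] at this
      exact this
    rw [← norm_algebraMap_padic] at h1
    simpa using h1
  refine ⟨((m : ℤ) : ZMod p), (reduces_intCast_iff (m : ℤ) x).2 ?_⟩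
  have e : x - ((m : ℤ) : ℂ_[p]) = (x - algebraMap ℚ_[p] ℂ_[p] Y) +
      (algebraMap ℚ_[p] ℂ_[p] Y - (m : ℤ)) := by ring
  rw [e]
  exact (IsUltrametricDist.norm_add_le_max _ _).trans_lt (max_lt hlt hm')

theorem reduces_unique {x : ℂ_[p]} {b c : ZMod p} (hb : Reduces x b) (hc : Reduces x c) :
    b = c := by
  have hb' : ‖x - (b.val : ℂ_[p])‖ < 1 := hb
  have hc' : ‖x - (c.val : ℂ_[p])‖ < 1 := hc
  have h : ‖(((b.val : ℤ) - (c.val : ℤ) : ℤ) : ℚ_[p])‖ < 1 := by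
    rw [← norm_algebraMap_padic]
    have e : algebraMap ℚ_[p] ℂ_[p] (((b.val : ℤ) - (c.val : ℤ) : ℤ) : ℚ_[p])
        = (x - (c.val : ℂ_[p])) + -(x - (b.val : ℂ_[p])) := by
      simp only [Int.cast_sub, Int.cast_natCast, map_sub, map_natCast]
      ring
    rw [e]
    exact (IsUltrametricDist.norm_add_le_max _ _).trans_lt (max_lt hc' (by rwa [norm_neg]))
  rw [Padic.norm_intCast_lt_one_iff, ← ZMod.intCast_zmod_eq_zero_iff_dvd] at h
  simpa [sub_eq_zero] using h

/-- Inversion is an isometry for the chordal distance and permutes `ℙ¹(ℚ_p)`. -/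
theorem hasLevel_inv_iff {x : ℂ_[p]} (hx : x ≠ 0) {l : ℕ} : HasLevel x⁻¹ l ↔ HasLevel x l := by
  have key : ∀ x : ℂ_[p], x ≠ 0 → Set.range (chordal x) ⊆ Set.range (chordal x⁻¹) := by
    intro x hx
    have hn : 0 < ‖x‖ := norm_pos_iff.2 hx
    have hmax : ∀ r : ℝ, 0 < r → max 1 r⁻¹ = max 1 r / r := by
      intro r hr
      rw [max_comm 1 r, ← max_div_div_right hr.le, div_self hr.ne', one_div]
    rintro _ ⟨y, rfl⟩
    induction y using OnePoint.rec with
    | infty =>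
      refine ⟨((0 : ℚ_[p]) : OnePoint ℚ_[p]), ?_⟩
      simp only [chordal, map_zero, sub_zero, norm_zero, norm_inv]
      rw [hmax _ hn]
      have := lt_of_lt_of_le one_pos (le_max_left 1 ‖x‖)
      simp
      field_simp
    | coe y =>
      rcases eq_or_ne y 0 with rfl | hy
      · refine ⟨∞, ?_⟩
        simp only [chordal, map_zero, sub_zero, norm_zero, norm_inv]
        rw [hmax _ hn]
        have := lt_of_lt_of_le one_pos (le_max_left 1 ‖x‖)
        simp
      · refine ⟨((y⁻¹ : ℚ_[p]) : OnePoint ℚ_[p]), ?_⟩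
        have hny : 0 < ‖y‖ := norm_pos_iff.2 hy
        have hyC : algebraMap ℚ_[p] ℂ_[p] y ≠ 0 := by
          rw [← norm_ne_zero_iff, norm_algebraMap_padic]
          exact hny.ne'
        have e : x⁻¹ - (algebraMap ℚ_[p] ℂ_[p] y)⁻¹
            = -((x - algebraMap ℚ_[p] ℂ_[p] y) / (x * algebraMap ℚ_[p] ℂ_[p] y)) := by
          field_simp
          ring
        simp only [chordal, norm_inv, map_inv₀]
        rw [hmax _ hn, hmax _ hny, e, norm_neg, norm_div, norm_mul, norm_algebraMap_padic]
        have h1 := lt_of_lt_of_le one_pos (le_max_left 1 ‖x‖)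
        have h2 := lt_of_lt_of_le one_pos (le_max_left 1 ‖y‖)
        field_simp
  have heq : Set.range (chordal x⁻¹) = Set.range (chordal x) := by
    refine Set.Subset.antisymm ?_ (key x hx)
    have h := key x⁻¹ (inv_ne_zero hx)
    rwa [inv_inv] at h
  rw [HasLevel, HasLevel, heq]

/-- Multiplication by `p⁻¹` sends the points of level `l` outside the open unit disk to the points
of level `l + 1` which are congruent to `∞`. -/
theorem hasLevel_prime_mul_iff {x : ℂ_[p]} (hx : x ≠ 0) {l : ℕ} (hl : l ≠ 0) :
    (1 ≤ ‖(p : ℂ_[p]) * x‖ ∧ HasLevel ((p : ℂ_[p]) * x) l) ↔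
      HasLevel x (l + 1) ∧ Reduces x ∞ := by
  have hp0 : (p : ℂ_[p]) ≠ 0 := prime_ne_zero
  have hpx : (p : ℂ_[p]) * x ≠ 0 := mul_ne_zero hp0 hx
  -- Inversion exchanges the neighbourhoods of `0` and `∞`, so this is the case `a = 0` at the point
  -- `(p x)⁻¹`.
  have h := hasLevel_affine_iff (p := p) 0 (x := ((p : ℂ_[p]) * x)⁻¹) hl
  have e : (p : ℂ_[p]) * ((p : ℂ_[p]) * x)⁻¹ = x⁻¹ := by field_simp
  rw [Int.cast_zero, add_zero, sub_zero, e, hasLevel_inv_iff hx, hasLevel_inv_iff hpx, norm_inv,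
    norm_inv, inv_le_one₀ (norm_pos_iff.2 hpx), inv_lt_one₀ (norm_pos_iff.2 hx)] at h
  exact h

end Level

/-! ### Affine substitutions -/

section Affine

variable {p : ℕ} [hp : Fact p.Prime] {ιinf : Qbar →+* ℂ} {ιp : Qbar →+* ℂ_[p]}

theorem adjoin_affine {q : ℚ} (hq : q ≠ 0) (r : ℚ) (τ : Qbar) :
    ℚ⟮(q : Qbar) * τ + (r : Qbar)⟯ = ℚ⟮τ⟯ := by
  have hq' : (q : Qbar) ≠ 0 := by exact_mod_cast hq
  have hrat : ∀ (x : Qbar) (s : ℚ), (s : Qbar) ∈ ℚ⟮x⟯ := fun x s => by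
    simp
  apply le_antisymm
  · rw [adjoin_simple_le_iff]
    exact add_mem (mul_mem (hrat _ q) (mem_adjoin_simple_self ℚ τ)) (hrat _ r)
  · rw [adjoin_simple_le_iff]
    have h : (q : Qbar)⁻¹ * (((q : Qbar) * τ + (r : Qbar)) - (r : Qbar)) ∈
        ℚ⟮(q : Qbar) * τ + (r : Qbar)⟯ :=
      mul_mem (inv_mem (hrat _ q)) (sub_mem (mem_adjoin_simple_self ℚ _) (hrat _ r))
    rwa [add_sub_cancel_right, inv_mul_cancel_left₀ hq'] at h

/-- The RM-point `q τ + r`. -/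
def RMPoint.affine (τ : RMPoint p ιinf ιp) (q : ℚ) (hq : q ≠ 0) (r : ℚ) : RMPoint p ιinf ιp where
  val := (q : Qbar) * τ + (r : Qbar)
  property := by
    refine ⟨?_, ?_, ?_, ?_⟩
    · rintro ⟨y, hy⟩
      apply τ.2.notMem_range
      have hq' : (q : ℂ_[p]) ≠ 0 := by exact_mod_cast hq
      refine ⟨(q : ℚ_[p])⁻¹ * (y - (r : ℚ_[p])), ?_⟩
      rw [map_mul, map_sub, hy, map_inv₀, map_ratCast, map_ratCast, map_add, map_mul, map_ratCast,
        map_ratCast, add_sub_cancel_right, inv_mul_cancel_left₀ hq']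
    · rw [adjoin_affine hq]
      exact τ.2.finrank_eq
    · rw [map_add, map_mul, map_ratCast, map_ratCast]
      simp [τ.2.real]
    · rw [adjoin_affine hq]
      exact τ.2.inert

@[simp]
theorem RMPoint.coe_affine (τ : RMPoint p ιinf ιp) (q : ℚ) (hq : q ≠ 0) (r : ℚ) :
    ((τ.affine q hq r : RMPoint p ιinf ιp) : Qbar) = (q : Qbar) * τ + (r : Qbar) := rfl

theorem RMPoint.eq_zero_of_linear (τ : RMPoint p ιinf ιp) {b c : ℚ}
    (h : (b : Qbar) * τ + (c : Qbar) = 0) : b = 0 ∧ c = 0 := by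
  by_contra hne
  exact τ.denom_ne hne h

theorem RMPoint.exists_quadratic (τ : RMPoint p ιinf ιp) :
    ∃ c : ℚ, (τ : Qbar) ^ 2 + ((minpoly ℚ (τ : Qbar)).coeff 1 : Qbar) * τ + (c : Qbar) = 0 := by
  have hfd : FiniteDimensional ℚ ℚ⟮(τ : Qbar)⟯ :=
    FiniteDimensional.of_finrank_pos (by rw [τ.2.finrank_eq]; exact two_pos)
  have hint : IsIntegral ℚ (τ : Qbar) :=
    (AdjoinSimple.isIntegral_gen ℚ (τ : Qbar)).1 (IsIntegral.of_finite ℚ _)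
  have hdeg : (minpoly ℚ (τ : Qbar)).natDegree = 2 := by
    rw [← IntermediateField.adjoin.finrank hint]
    exact τ.2.finrank_eq
  refine ⟨(minpoly ℚ (τ : Qbar)).coeff 0, ?_⟩
  have h := minpoly.aeval ℚ (τ : Qbar)
  have hlead : (minpoly ℚ (τ : Qbar)).coeff 2 = 1 := by
    have := (minpoly.monic hint).coeff_natDegree
    rwa [hdeg] at this
  rw [Polynomial.aeval_eq_sum_range, hdeg] at h
  simp only [Finset.sum_range_succ, Finset.sum_range_zero, hlead, Algebra.smul_def,
    eq_ratCast, Rat.cast_one] at h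
  linear_combination h

/-- Two monic rational quadratic relations for the irrational number `τ` coincide, so any one of
them determines the conjugate. -/
theorem RMPoint.conj_eq (τ : RMPoint p ιinf ιp) {b c : ℚ}
    (h : (τ : Qbar) ^ 2 + (b : Qbar) * τ + (c : Qbar) = 0) : conj τ = -(b : Qbar) - τ := by
  obtain ⟨c', h'⟩ := τ.exists_quadratic
  have hlin : (((minpoly ℚ (τ : Qbar)).coeff 1 - b : ℚ) : Qbar) * τ + ((c' - c : ℚ) : Qbar) = 0 := by
    push_cast
    linear_combination h' - h
  have h1 := (τ.eq_zero_of_linear hlin).1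
  rw [conj, sub_eq_zero.1 h1]
  simp

theorem RMPoint.conj_affine (τ : RMPoint p ιinf ιp) (q : ℚ) (hq : q ≠ 0) (r : ℚ) :
    conj (τ.affine q hq r) = (q : Qbar) * conj τ + (r : Qbar) := by
  obtain ⟨c, h⟩ := τ.exists_quadratic
  rw [τ.conj_eq h]
  have h2 : ((τ.affine q hq r : RMPoint p ιinf ιp) : Qbar) ^ 2 +
      ((q * (minpoly ℚ (τ : Qbar)).coeff 1 - 2 * r : ℚ) : Qbar) * (τ.affine q hq r) +
      ((r ^ 2 - q * r * (minpoly ℚ (τ : Qbar)).coeff 1 + q ^ 2 * c : ℚ) : Qbar) = 0 := by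
    rw [RMPoint.coe_affine]
    push_cast
    linear_combination (q : Qbar) ^ 2 * h
  rw [RMPoint.conj_eq _ h2, RMPoint.coe_affine]
  push_cast
  ring

theorem RMPoint.conj_ne (τ : RMPoint p ιinf ιp) : (τ : Qbar) ≠ conj τ := by
  obtain ⟨c, h⟩ := τ.exists_quadratic
  rw [τ.conj_eq h]
  intro h0
  have : ((2 : ℚ) : Qbar) * τ + ((minpoly ℚ (τ : Qbar)).coeff 1 : Qbar) = 0 := by
    push_cast
    linear_combination h0
  exact absurd (τ.eq_zero_of_linear this).1 two_ne_zero

theorem prime_ne_zero_rat : (p : ℚ) ≠ 0 := by exact_mod_cast hp.out.ne_zero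

/-- The points `p τ` and `p τ + a` differ by the translation `(1 a; 0 1)` of `Γ`. -/
theorem RMPoint.orbit_affine (τ : RMPoint p ιinf ιp) (a : ℤ) :
    (τ.affine p prime_ne_zero_rat a).orbit = RMOrbit.mulP τ.orbit := by
  refine (Quotient.sound (s := RMPoint.setoid p ιinf ιp) ?_).symm
  let γ : Ihara p := ⟨!![1, (a : ZInv p); 0, 1], by simp [Matrix.det_fin_two_of]⟩
  refine ⟨γ, ?_⟩
  have e00 : γ.toMatrix 0 0 = 1 := rfl
  have e01 : γ.toMatrix 0 1 = a := rfl
  have e10 : γ.toMatrix 1 0 = 0 := rfl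
  have e11 : γ.toMatrix 1 1 = 1 := rfl
  rw [RMPoint.coe_affine, mobius, e00, e01, e10, e11]
  change _ = (_ * ((p : Qbar) * τ) + _) / _
  push_cast
  ring

/-- The matrix `diag(p, p⁻¹)` of `Γ` sends `τ` to `p² τ`. -/
theorem mulP_mulP (o : RMOrbit p ιinf ιp) : RMOrbit.mulP (RMOrbit.mulP o) = o := by
  induction o using Quotient.inductionOn with
  | h τ =>
    refine (Quotient.sound (s := RMPoint.setoid p ιinf ιp) ?_).symm
    have hp0 : (p : Qbar) ≠ 0 := by exact_mod_cast hp.out.ne_zero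
    let P : ZInv p := ⟨(p : ℚ), _root_.natCast_mem _ p⟩
    let Q : ZInv p := ⟨(p : ℚ)⁻¹, Subring.subset_closure rfl⟩
    have hPQ : P * Q = 1 := Subtype.ext (mul_inv_cancel₀ prime_ne_zero_rat)
    let γ : Ihara p := ⟨!![P, 0; 0, Q], by simp [Matrix.det_fin_two_of, hPQ]⟩
    refine ⟨γ, ?_⟩
    have e00 : γ.toMatrix 0 0 = p := rfl
    have e01 : γ.toMatrix 0 1 = 0 := rfl
    have e10 : γ.toMatrix 1 0 = 0 := rfl
    have e11 : γ.toMatrix 1 1 = (p : ℚ)⁻¹ := rfl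
    rw [mobius, e00, e01, e10, e11]
    change (p : Qbar) * ((p : Qbar) * τ) = _
    push_cast
    field_simp
    simp

theorem mulP_injective : Function.Injective (RMOrbit.mulP (p := p) (ιinf := ιinf) (ιp := ιp)) :=
  Function.LeftInverse.injective mulP_mulP

theorem neg_varpi_mulP (D : RMDivisor p ιinf ιp) (o : RMOrbit p ιinf ιp) :
    (-(varpi D)) (RMOrbit.mulP o) = D o := by
  simp [varpi, Finsupp.mapDomain_apply mulP_injective]

-- An increasing affine map of the real line fixes `∞` and preserves the order relations that define
-- the left side.
open Classical in
theorem geodesicInter_affine {q : ℝ} (hq : 0 < q) {r α β : ℝ} {c c' : ℚ}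
    (hc : (c' : ℝ) = q * c + r) :
    geodesicInter (q * α + r) (q * β + r) (c' : OnePoint ℚ) ∞
      = geodesicInter α β (c : OnePoint ℚ) ∞ := by
  have h : ∀ x y : ℝ, q * x + r < q * y + r ↔ x < y := fun x y => by
    rw [add_lt_add_iff_right, mul_lt_mul_iff_right₀ hq]
  have h1 : OnLeft (q * α + r) (q * β + r) (c' : OnePoint ℚ) ↔ OnLeft α β (c : OnePoint ℚ) := by
    simp only [OnLeft, hc, h]
  have h2 : OnLeft (q * α + r) (q * β + r) ∞ ↔ OnLeft α β ∞ := by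
    simp only [OnLeft, h]
  rw [geodesicInter, geodesicInter]
  congr 1
  · exact if_congr h2 rfl rfl
  · exact if_congr h1 rfl rfl

theorem RMPoint.inter_affine (τ : RMPoint p ιinf ιp) {q : ℚ} (hq : 0 < q) (r c : ℚ) :
    (τ.affine q hq.ne' r).inter ((q * c + r : ℚ) : OnePoint ℚ) ∞ = τ.inter (c : OnePoint ℚ) ∞ := by
  have hre : ∀ x : Qbar, (ιinf ((q : Qbar) * x + (r : Qbar))).re = (q : ℝ) * (ιinf x).re + r := by
    intro x
    rw [map_add, map_mul, map_ratCast, map_ratCast]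
    simp
  rw [RMPoint.inter, RMPoint.inter, RMPoint.conj_affine, RMPoint.coe_affine, hre, hre]
  exact geodesicInter_affine (by exact_mod_cast hq) (by push_cast; ring)

/-- The numerator acquires `q` once for each of its two `n/2`-th powers, the denominator only once.
-/
theorem RMPoint.poly_affine (n : ℕ) (τ : RMPoint p ιinf ιp) (q : ℚ) (hq : q ≠ 0) (r : ℚ) :
    ((τ.affine q hq r).poly n).comp
        (Polynomial.C (q : ℂ_[p]) * Polynomial.X + Polynomial.C (r : ℂ_[p]))
      = Polynomial.C ((q : ℂ_[p]) ^ (n / 2)) * τ.poly n := by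
  have hq' : (q : ℂ_[p]) ≠ 0 := by exact_mod_cast hq
  have hne : ιp τ - ιp (conj τ) ≠ 0 := by
    rw [sub_ne_zero]
    exact fun h => τ.conj_ne (ιp.injective h)
  have hconj : conj ((q : Qbar) * τ + (r : Qbar)) = (q : Qbar) * conj τ + (r : Qbar) :=
    τ.conj_affine q hq r
  simp only [RMPoint.poly, RMPoint.coe_affine, hconj, map_add, map_mul, map_ratCast]
  have e1 : ∀ x : ℂ_[p], Polynomial.C (q : ℂ_[p]) * Polynomial.X + Polynomial.C (r : ℂ_[p]) -
      (Polynomial.C (q : ℂ_[p]) * Polynomial.C x + Polynomial.C (r : ℂ_[p]))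
      = Polynomial.C (q : ℂ_[p]) * (Polynomial.X - Polynomial.C x) := fun x => by ring
  have e2 : ((q : ℂ_[p]) * ιp τ + r - (q * ιp (conj τ) + r)) = q * (ιp τ - ιp (conj τ)) := by ring
  simp only [Polynomial.mul_comp, Polynomial.C_comp, Polynomial.pow_comp, Polynomial.sub_comp,
    Polynomial.X_comp, Polynomial.add_comp, e1, e2, mul_pow]
  have e3 : Polynomial.C (((q : ℂ_[p]) ^ (n / 2) * (ιp τ - ιp (conj τ)) ^ (n / 2))⁻¹) *
      Polynomial.C (q : ℂ_[p]) ^ (n / 2) = Polynomial.C (((ιp τ - ιp (conj τ)) ^ (n / 2))⁻¹) := by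
    rw [← Polynomial.C_pow, ← Polynomial.C_mul]
    congr 1
    field_simp
  rw [← e3, Polynomial.C_pow]
  ring

theorem pointPairing_affine (n : ℕ) (τ : RMPoint p ιinf ιp) (q : ℚ) (hq : q ≠ 0) (r : ℚ)
    (G : ℂ_[p] → ℂ_[p]) :
    (q : ℂ_[p]) ^ n * pointPairing n G (τ.affine q hq r)
      = (q : ℂ_[p]) ^ (n / 2) *
        pointPairing n (fun t => G ((q : ℂ_[p]) * t + (r : ℂ_[p]))) τ := by
  have h := polyPairing_taylorPoly_affine (natDegree_poly_le n τ)
    (natDegree_poly_le n (τ.affine q hq r)) (τ.poly_affine n q hq r) G (ιp τ)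
  rw [pointPairing, RMPoint.coe_affine, map_add, map_mul, map_ratCast, map_ratCast]
  exact h

theorem affine_mem_unramK_iff {q : ℚ} (hq : q ≠ 0) (r : ℚ) (x : ℂ_[p]) :
    (q : ℂ_[p]) * x + (r : ℂ_[p]) ∈ unramK p ↔ x ∈ unramK p := by
  have hq' : (q : ℂ_[p]) ≠ 0 := by exact_mod_cast hq
  have hrat : ∀ s : ℚ, (s : ℂ_[p]) ∈ unramK p := fun s => by
    simp
  constructor
  · intro h
    have h' := mul_mem (inv_mem (hrat q)) (sub_mem h (hrat r))
    rwa [add_sub_cancel_right, inv_mul_cancel_left₀ hq'] at h'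
  · intro h
    exact add_mem (mul_mem (hrat q) h) (hrat r)

theorem RMPoint.affine_injective (q : ℚ) (hq : q ≠ 0) (r : ℚ) :
    Function.Injective fun τ : RMPoint p ιinf ιp => τ.affine q hq r := by
  intro τ τ' h
  have h' := congrArg (fun x : RMPoint p ιinf ιp => (x : Qbar)) h
  have hq' : (q : Qbar) ≠ 0 := by exact_mod_cast hq
  simp only [RMPoint.coe_affine] at h'
  exact Subtype.ext (mul_left_cancel₀ hq' (add_right_cancel h'))

theorem RMPoint.affine_surjective (q : ℚ) (hq : q ≠ 0) (r : ℚ) :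
    Function.Surjective fun τ : RMPoint p ιinf ιp => τ.affine q hq r := by
  intro τ
  refine ⟨τ.affine q⁻¹ (inv_ne_zero hq) (-r / q), Subtype.ext ?_⟩
  have hq' : (q : Qbar) ≠ 0 := by exact_mod_cast hq
  simp only [RMPoint.coe_affine]
  push_cast
  field_simp
  ring

end Affine

/-! ### Finiteness of the set of points of given level -/

section Finiteness

variable {p : ℕ} [hp : Fact p.Prime] {ιinf : Qbar →+* ℂ} {ιp : Qbar →+* ℂ_[p]}

theorem exists_pow_mul_eq_intCast {q : ℚ} (hq : q ∈ ZInv p) :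
    ∃ (N : ℕ) (m : ℤ), (p : ℚ) ^ N * q = m := by
  have hp0 : (p : ℚ) ≠ 0 := prime_ne_zero_rat
  induction hq using Subring.closure_induction with
  | mem x hx =>
    rw [Set.mem_singleton_iff.1 hx]
    exact ⟨1, 1, by rw [pow_one, mul_inv_cancel₀ hp0, Int.cast_one]⟩
  | zero => exact ⟨0, 0, by simp⟩
  | one => exact ⟨0, 1, by simp⟩
  | add x y _ _ hx hy =>
    obtain ⟨N, m, h⟩ := hx
    obtain ⟨N', m', h'⟩ := hy
    refine ⟨N + N', p ^ N' * m + p ^ N * m', ?_⟩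
    push_cast
    rw [← h, ← h', pow_add]
    ring
  | neg x _ hx =>
    obtain ⟨N, m, h⟩ := hx
    exact ⟨N, -m, by push_cast; rw [← h]; ring⟩
  | mul x y _ _ hx hy =>
    obtain ⟨N, m, h⟩ := hx
    obtain ⟨N', m', h'⟩ := hy
    refine ⟨N + N', m * m', ?_⟩
    push_cast
    rw [← h, ← h', pow_add]
    ring

theorem exists_intCast_of_norm_le {q : ℚ} (hq : q ∈ ZInv p) {N : ℕ}
    (h : ‖(q : ℚ_[p])‖ ≤ (p : ℝ) ^ N) : ∃ m : ℤ, (p : ℚ) ^ N * q = m := by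
  have hp0 : (p : ℚ) ≠ 0 := prime_ne_zero_rat
  have hpR : (0 : ℝ) < p := by exact_mod_cast hp.out.pos
  obtain ⟨N', m, hm⟩ := exists_pow_mul_eq_intCast hq
  have hm' : ((p : ℚ_[p]) ^ N' * (q : ℚ_[p])) = (m : ℚ_[p]) := by exact_mod_cast hm
  have hnorm : ‖((m * (p : ℤ) ^ N : ℤ) : ℚ_[p])‖ ≤ (p : ℝ) ^ (-(N' : ℤ)) := by
    push_cast
    rw [← hm', norm_mul, norm_mul, norm_pow, norm_pow, Padic.norm_p, zpow_neg, zpow_natCast,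
      inv_pow, inv_pow, mul_assoc]
    have h1 : ‖(q : ℚ_[p])‖ * ((p : ℝ) ^ N)⁻¹ ≤ 1 := by
      rw [mul_inv_le_iff₀ (by positivity), one_mul]
      exact h
    exact mul_le_of_le_one_right (by positivity) h1
  rw [Padic.norm_int_le_pow_iff_dvd] at hnorm
  obtain ⟨m', hm''⟩ := hnorm
  refine ⟨m', ?_⟩
  have h2 : (m : ℚ) * (p : ℚ) ^ N = (p : ℚ) ^ N' * m' := by exact_mod_cast hm''
  rw [← hm] at h2
  apply mul_left_cancel₀ (pow_ne_zero N' hp0)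
  linear_combination h2

theorem finite_ZInv_bounded (N : ℕ) (R : ℚ) :
    {q : ℚ | q ∈ ZInv p ∧ ‖(q : ℚ_[p])‖ ≤ (p : ℝ) ^ N ∧ |q| ≤ R}.Finite := by
  have hpQ : (0 : ℚ) < p := by exact_mod_cast hp.out.pos
  refine ((Set.finite_Icc (-⌈(p : ℚ) ^ N * R⌉) ⌈(p : ℚ) ^ N * R⌉).image
    fun m : ℤ => (m : ℚ) / (p : ℚ) ^ N).subset ?_
  rintro q ⟨hq, hn, hR⟩
  obtain ⟨m, hm⟩ := exists_intCast_of_norm_le hq hn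
  have habs : |(m : ℚ)| ≤ ⌈(p : ℚ) ^ N * R⌉ := by
    refine le_trans ?_ (Int.le_ceil _)
    rw [← hm, abs_mul, abs_of_pos (pow_pos hpQ N)]
    exact mul_le_mul_of_nonneg_left hR (pow_pos hpQ N).le
  refine ⟨m, ?_, ?_⟩
  · rw [Set.mem_Icc, ← abs_le]
    exact_mod_cast habs
  · change (m : ℚ) / _ = q
    rw [← hm, mul_div_cancel_left₀ _ (pow_pos hpQ N).ne']

/-- After clearing the denominator, a nonzero integer has absolute value at least `1`. This turns a
bound on a product of coefficients into a bound on each factor. -/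
theorem inv_pow_le_abs_of_norm_le {q : ℚ} (hq : q ∈ ZInv p) (hq0 : q ≠ 0) {N : ℕ}
    (h : ‖(q : ℚ_[p])‖ ≤ (p : ℝ) ^ N) : 1 ≤ (p : ℚ) ^ N * |q| := by
  have hpQ : (0 : ℚ) < p := by exact_mod_cast hp.out.pos
  obtain ⟨m, hm⟩ := exists_intCast_of_norm_le hq h
  have hm0 : m ≠ 0 := by
    rintro rfl
    rw [Int.cast_zero, mul_eq_zero] at hm
    exact hm.elim (pow_pos hpQ N).ne' hq0
  rw [← abs_of_pos (pow_pos hpQ N), ← abs_mul, hm]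
  exact_mod_cast Int.one_le_abs hm0

/-- The coefficients of a quadratic form of discriminant `Δ` with a root of level `l` are bounded
`p`-adically. -/
theorem exists_coeff_norm_bound (Δ : ℚ) (l : ℕ) : ∃ N : ℕ, ∀ (x : ℂ_[p]) (A B C : ℚ), A ≠ 0 →
    HasLevel x l → (A : ℂ_[p]) * x ^ 2 + (B : ℂ_[p]) * x + (C : ℂ_[p]) = 0 →
    B ^ 2 - 4 * A * C = Δ → ‖(A : ℚ_[p])‖ ≤ (p : ℝ) ^ N ∧ ‖(B : ℚ_[p])‖ ≤ (p : ℝ) ^ N ∧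
      ‖(C : ℚ_[p])‖ ≤ (p : ℝ) ^ N := by
  have hp1 : (1 : ℝ) < p := one_lt_prime_real
  set L : ℝ := (p : ℝ) ^ l with hL
  have hL1 : 1 ≤ L := one_le_pow₀ hp1.le
  -- A quantity `s` with `s² = |Δ|` satisfies `s ≤ 1 + s²`, which avoids square roots.
  set D : ℝ := 1 + ‖(Δ : ℂ_[p])‖ with hD
  have h2pos : 0 < ‖(2 : ℂ_[p])‖ := norm_pos_iff.2 two_ne_zero
  have h2le : ‖(2 : ℂ_[p])‖ ≤ 1 := by
    simpa using IsUltrametricDist.norm_natCast_le_one ℂ_[p] 2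
  set M : ℝ := L * (D / ‖(2 : ℂ_[p])‖) with hM
  obtain ⟨N, hN⟩ := pow_unbounded_of_one_lt (M * L ^ 2) hp1
  refine ⟨N, ?_⟩
  intro x A B C hA hlev hx hΔ
  have hrat : ∀ q : ℚ, ‖(q : ℚ_[p])‖ = ‖(q : ℂ_[p])‖ := fun q => by
    rw [← norm_algebraMap_padic, map_ratCast]
  rw [hrat, hrat, hrat]
  have hA' : (A : ℂ_[p]) ≠ 0 := by exact_mod_cast hA
  have hApos : 0 < ‖(A : ℂ_[p])‖ := norm_pos_iff.2 hA'
  have hzl : (p : ℝ) ^ (-(l : ℤ)) = L⁻¹ := by rw [zpow_neg, zpow_natCast]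
  set X : ℝ := max 1 ‖x‖ with hX
  have hX1 : 1 ≤ X := le_max_left _ _
  have hXL : X ≤ L := by
    have h := hlev.2 ⟨∞, rfl⟩
    rw [hzl] at h
    change L⁻¹ ≤ 1 / X at h
    rw [one_div] at h
    exact (inv_le_inv₀ (by linarith) (by linarith)).1 h
  -- The midpoint of the two roots is rational, so the level bounds its distance to `x` from below,
  -- while `2A(x - y)` is a square root of `Δ`. Together these bound `A`.
  set y : ℚ_[p] := ((-B / (2 * A) : ℚ) : ℚ_[p]) with hy
  set Y : ℝ := max 1 ‖y‖ with hY
  have hY1 : 1 ≤ Y := le_max_left _ _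
  have hyC : algebraMap ℚ_[p] ℂ_[p] y = -(B : ℂ_[p]) / (2 * A) := by
    rw [hy, map_ratCast]
    push_cast
    ring
  have hsq : (2 * A * (x - algebraMap ℚ_[p] ℂ_[p] y)) ^ 2 = (Δ : ℂ_[p]) := by
    rw [hyC, ← hΔ]
    push_cast
    field_simp
    linear_combination (4 * (A : ℂ_[p])) * hx
  set d : ℝ := ‖x - algebraMap ℚ_[p] ℂ_[p] y‖ with hd
  have hs : ‖(2 : ℂ_[p])‖ * ‖(A : ℂ_[p])‖ * d ≤ D := by
    have h := congrArg norm hsq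
    rw [norm_pow, norm_mul, norm_mul] at h
    nlinarith [sq_nonneg (‖(2 : ℂ_[p])‖ * ‖(A : ℂ_[p])‖ * d - 1), norm_nonneg (Δ : ℂ_[p])]
  have hXY : X * Y ≤ L * d := by
    have h := hlev.2 ⟨(y : OnePoint ℚ_[p]), rfl⟩
    rw [hzl] at h
    change L⁻¹ ≤ d / (X * Y) at h
    rw [le_div_iff₀ (by positivity), inv_mul_le_iff₀ (by linarith)] at h
    exact h
  have hAXY : ‖(A : ℂ_[p])‖ * (X * Y) ≤ M := by
    calc ‖(A : ℂ_[p])‖ * (X * Y) ≤ ‖(A : ℂ_[p])‖ * (L * d) := by gcongr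
      _ = L * (‖(A : ℂ_[p])‖ * d) := by ring
      _ ≤ L * (D / ‖(2 : ℂ_[p])‖) := by
        gcongr
        rw [le_div_iff₀ h2pos]
        linarith
  have hMN : ∀ r : ℝ, r ≤ M * L ^ 2 → r ≤ (p : ℝ) ^ N := fun r hr => hr.trans hN.le
  have hM0 : 0 ≤ M := le_trans (by positivity) hAXY
  have hL2 : 1 ≤ L ^ 2 := one_le_pow₀ hL1
  have hAle : ‖(A : ℂ_[p])‖ ≤ M := by
    refine le_trans ?_ hAXY
    exact le_mul_of_one_le_right hApos.le (one_le_mul_of_one_le_of_one_le hX1 hY1)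
  have hxL : ‖x‖ ≤ L := (le_max_right _ _).trans hXL
  have hBle : ‖(B : ℂ_[p])‖ ≤ M := by
    have e : (B : ℂ_[p]) = -(2 * A * algebraMap ℚ_[p] ℂ_[p] y) := by
      rw [hyC]
      field_simp
    rw [e, norm_neg, norm_mul, norm_mul, norm_algebraMap_padic]
    refine le_trans ?_ hAXY
    have h1 : ‖y‖ ≤ X * Y := (le_max_right 1 ‖y‖).trans (le_mul_of_one_le_left (by linarith) hX1)
    calc ‖(2 : ℂ_[p])‖ * ‖(A : ℂ_[p])‖ * ‖y‖ ≤ 1 * ‖(A : ℂ_[p])‖ * (X * Y) := by gcongr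
      _ = _ := by ring
  refine ⟨hMN _ (hAle.trans (le_mul_of_one_le_right hM0 hL2)),
    hMN _ (hBle.trans (le_mul_of_one_le_right hM0 hL2)), hMN _ ?_⟩
  have e : (C : ℂ_[p]) = -(A * x ^ 2) + -(B * x) := by linear_combination hx
  rw [e]
  refine (IsUltrametricDist.norm_add_le_max _ _).trans (max_le ?_ ?_)
  · rw [norm_neg, norm_mul, norm_pow]
    gcongr
  · rw [norm_neg, norm_mul]
    have : ‖x‖ ≤ L ^ 2 := hxL.trans (le_self_pow₀ hL1 two_ne_zero)
    gcongr

/-- If `α` and `β` have the same sign, `0` and `∞` lie on the same side of the geodesic. -/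
theorem mul_nonpos_of_geodesicInter_ne_zero {α β : ℝ}
    (h : geodesicInter α β ((0 : ℚ) : OnePoint ℚ) ∞ ≠ 0) : α * β ≤ 0 := by
  by_contra hpos
  rw [not_le] at hpos
  apply h
  rw [geodesicInter, sub_eq_zero]
  have hiff : OnLeft α β ∞ ↔ OnLeft α β ((0 : ℚ) : OnePoint ℚ) := by
    simp only [OnLeft, Rat.cast_zero]
    constructor
    · intro hlt
      refine Or.inr ⟨hlt, ?_⟩
      rcases pos_and_pos_or_neg_and_neg_of_mul_pos hpos with h | h
      · exact Or.inl h.1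
      · exact Or.inr h.2
    · rintro (⟨h1, h2⟩ | h1)
      · nlinarith
      · exact h1.1
  by_cases h1 : OnLeft α β ∞
  · rw [if_pos h1, if_pos (hiff.1 h1)]
  · rw [if_neg h1, if_neg fun h2 => h1 (hiff.2 h2)]

/-- The quotient `C / A` is the product of the two real roots, which the path from `0` to `∞`
separates. -/
theorem RMPoint.coeff_mul_nonpos (w : RMPoint p ιinf ιp) {A B C : ℚ} (hA : A ≠ 0)
    (h : (A : Qbar) * (w : Qbar) ^ 2 + (B : Qbar) * w + (C : Qbar) = 0)
    (hw : w.inter ((0 : ℚ) : OnePoint ℚ) ∞ ≠ 0) : A * C ≤ 0 := by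
  have hA' : (A : Qbar) ≠ 0 := by exact_mod_cast hA
  have hmonic : (w : Qbar) ^ 2 + ((B / A : ℚ) : Qbar) * w + ((C / A : ℚ) : Qbar) = 0 := by
    push_cast
    field_simp
    linear_combination h
  have hnp := mul_nonpos_of_geodesicInter_ne_zero hw
  have hre : ιinf w = ((ιinf w).re : ℂ) := by
    apply Complex.ext
    · simp
    · simpa using w.2.real
  have h1 := congrArg ιinf h
  simp only [map_add, map_mul, map_pow, map_ratCast, map_zero] at h1
  rw [hre] at h1
  have h2 : (A : ℝ) * (ιinf w).re ^ 2 + B * (ιinf w).re + C = 0 := by exact_mod_cast h1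
  have h3 : (ιinf (conj w)).re = -((B : ℝ) / A) - (ιinf w).re := by
    rw [w.conj_eq hmonic, map_sub, map_neg, map_ratCast]
    simp
  rw [h3] at hnp
  have hAR : (A : ℝ) ≠ 0 := by exact_mod_cast hA
  have h4 : (A : ℝ) * C = A ^ 2 * ((ιinf w).re * (-((B : ℝ) / A) - (ιinf w).re)) := by
    field_simp
    linear_combination h2
  have h5 : (A : ℝ) * C ≤ 0 := by
    rw [h4]
    exact mul_nonpos_of_nonneg_of_nonpos (sq_nonneg _) hnp
  exact_mod_cast h5

theorem RMPoint.exists_int_quadratic (τ : RMPoint p ιinf ιp) : ∃ A B C : ℤ, A ≠ 0 ∧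
    (A : Qbar) * (τ : Qbar) ^ 2 + (B : Qbar) * τ + (C : Qbar) = 0 := by
  obtain ⟨c, h⟩ := τ.exists_quadratic
  set b := (minpoly ℚ (τ : Qbar)).coeff 1
  refine ⟨b.den * c.den, b.num * c.den, c.num * b.den, ?_, ?_⟩
  · exact_mod_cast mul_ne_zero b.den_ne_zero c.den_ne_zero
  · have hb : (b : Qbar) * (b.den : Qbar) = (b.num : Qbar) := by exact_mod_cast Rat.mul_den_eq_num b
    have hc : (c : Qbar) * (c.den : Qbar) = (c.num : Qbar) := by exact_mod_cast Rat.mul_den_eq_num c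
    push_cast
    rw [← hb, ← hc]
    linear_combination ((b.den : Qbar) * c.den) * h

/-- The points of a `Γ`-orbit are roots of quadratic forms over `ℤ[1/p]` of the same
discriminant. -/
theorem RMPoint.exists_form_of_rel {τ : RMPoint p ιinf ιp} {A₀ B₀ C₀ : ℤ}
    (h₀ : (A₀ : Qbar) * (τ : Qbar) ^ 2 + (B₀ : Qbar) * τ + (C₀ : Qbar) = 0)
    {w : RMPoint p ιinf ιp} (hw : w.Rel τ) : ∃ A B C : ℚ, A ∈ ZInv p ∧ B ∈ ZInv p ∧ C ∈ ZInv p ∧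
      (A : Qbar) * (w : Qbar) ^ 2 + (B : Qbar) * w + (C : Qbar) = 0 ∧
      B ^ 2 - 4 * A * C = (B₀ : ℚ) ^ 2 - 4 * A₀ * C₀ := by
  obtain ⟨γ, hγ⟩ := hw
  have hd := w.denom_ne γ.bottom_ne
  have hdet := γ.det_eq
  have hmem : ∀ i j, γ.toMatrix i j ∈ ZInv p := fun i j => (γ.1 i j).2
  have hint : ∀ m : ℤ, (m : ℚ) ∈ ZInv p := fun m => _root_.intCast_mem _ m
  rw [mobius, eq_div_iff hd] at hγ
  set α := γ.toMatrix 0 0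
  set β := γ.toMatrix 0 1
  set c := γ.toMatrix 1 0
  set d := γ.toMatrix 1 1
  have hα : α ∈ ZInv p := hmem 0 0
  have hβ : β ∈ ZInv p := hmem 0 1
  have hc : c ∈ ZInv p := hmem 1 0
  have hd' : d ∈ ZInv p := hmem 1 1
  have htwo : (2 : ℚ) ∈ ZInv p := by simp
  refine ⟨A₀ * α ^ 2 + B₀ * (α * c) + C₀ * c ^ 2,
    2 * A₀ * (α * β) + B₀ * (α * d + β * c) + 2 * C₀ * (c * d),
    A₀ * β ^ 2 + B₀ * (β * d) + C₀ * d ^ 2, ?_, ?_, ?_, ?_, ?_⟩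
  · exact add_mem (add_mem (mul_mem (hint _) (pow_mem hα 2)) (mul_mem (hint _) (mul_mem hα hc)))
      (mul_mem (hint _) (pow_mem hc 2))
  · exact add_mem (add_mem (mul_mem (mul_mem htwo (hint _)) (mul_mem hα hβ))
      (mul_mem (hint _) (add_mem (mul_mem hα hd') (mul_mem hβ hc))))
      (mul_mem (mul_mem htwo (hint _)) (mul_mem hc hd'))
  · exact add_mem (add_mem (mul_mem (hint _) (pow_mem hβ 2)) (mul_mem (hint _) (mul_mem hβ hd')))
      (mul_mem (hint _) (pow_mem hd' 2))
  · push_cast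
    have e : (A₀ : Qbar) * (α * w + β) ^ 2 + B₀ * ((α * w + β) * (c * w + d)) +
        C₀ * (c * w + d) ^ 2 = 0 := by
      rw [← hγ]
      linear_combination ((c : Qbar) * w + d) ^ 2 * h₀
    linear_combination e
  · linear_combination ((B₀ : ℚ) ^ 2 - 4 * A₀ * C₀) * (α * d - β * c + 1) * hdet

theorem finite_orbit_level (o : RMOrbit p ιinf ιp) (l : ℕ) :
    {w : RMPoint p ιinf ιp | w.orbit = o ∧ w.inter ((0 : ℚ) : OnePoint ℚ) ∞ ≠ 0 ∧
      HasLevel (ιp w) l}.Finite := by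
  induction o using Quotient.inductionOn with
  | h τ =>
    obtain ⟨A₀, B₀, C₀, hA₀, h₀⟩ := τ.exists_int_quadratic
    set Δ : ℚ := (B₀ : ℚ) ^ 2 - 4 * A₀ * C₀ with hΔ
    obtain ⟨N, hN⟩ := exists_coeff_norm_bound (p := p) Δ l
    set R : ℚ := (p : ℚ) ^ N * (1 + |Δ|) with hR
    set T : Set ℚ := {q : ℚ | q ∈ ZInv p ∧ ‖(q : ℚ_[p])‖ ≤ (p : ℝ) ^ N ∧ |q| ≤ R} with hT
    have hTfin : T.Finite := finite_ZInv_bounded N R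
    have hΔ0 : Δ ≠ 0 := by
      intro h
      have h1 : ((B₀ : Qbar) ^ 2 - 4 * A₀ * C₀) = 0 := by
        rw [hΔ] at h
        exact_mod_cast h
      have h2 : (((2 * A₀ : ℚ) : Qbar) * τ + ((B₀ : ℚ) : Qbar)) ^ 2 = 0 := by
        push_cast
        linear_combination (4 * (A₀ : Qbar)) * h₀ + h1
      have h3 := (τ.eq_zero_of_linear (pow_eq_zero_iff two_ne_zero |>.1 h2)).1
      rw [mul_eq_zero] at h3
      exact h3.elim two_ne_zero (by exact_mod_cast hA₀)
    have hroots : ∀ v ∈ T ×ˢ (T ×ˢ T), v.1 ≠ 0 → {w : RMPoint p ιinf ιp |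
        (v.1 : Qbar) * (w : Qbar) ^ 2 + (v.2.1 : Qbar) * w + (v.2.2 : Qbar) = 0}.Finite := by
      intro v _ hv
      have hpoly : (Polynomial.C (v.1 : Qbar) * Polynomial.X ^ 2 +
          Polynomial.C (v.2.1 : Qbar) * Polynomial.X + Polynomial.C (v.2.2 : Qbar)) ≠ 0 := by
        intro h
        have h2 := congrArg (fun f => Polynomial.coeff f 2) h
        simp at h2
        exact hv h2
      refine ((Polynomial.finite_setOfPred_isRoot hpoly).preimage
        Subtype.val_injective.injOn).subset fun w hw => ?_
      simpa [Polynomial.IsRoot] using hw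
    have hfin : (⋃ v ∈ T ×ˢ (T ×ˢ T), {w : RMPoint p ιinf ιp | v.1 ≠ 0 ∧
        (v.1 : Qbar) * (w : Qbar) ^ 2 + (v.2.1 : Qbar) * w + (v.2.2 : Qbar) = 0}).Finite := by
      refine (hTfin.prod (hTfin.prod hTfin)).biUnion fun v hv => ?_
      by_cases h0 : v.1 = 0
      · simp [h0]
      · exact (hroots v hv h0).subset fun w hw => hw.2
    refine hfin.subset ?_
    rintro w ⟨hw, hinter, hlev⟩
    obtain ⟨A, B, C, hAm, hBm, hCm, hform, hdisc⟩ :=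
      RMPoint.exists_form_of_rel h₀ (Quotient.exact (s := RMPoint.setoid p ιinf ιp) hw)
    rw [← hΔ] at hdisc
    have hA : A ≠ 0 := by
      rintro rfl
      rw [Rat.cast_zero, zero_mul, zero_add] at hform
      obtain ⟨rfl, rfl⟩ := w.eq_zero_of_linear hform
      exact hΔ0 (by rw [← hdisc]; ring)
    have hC : C ≠ 0 := by
      rintro rfl
      have hw0 : (w : Qbar) ≠ 0 := by simpa using w.ne_rat 0
      have h1 : (A : Qbar) * w + (B : Qbar) = 0 := by
        apply mul_left_cancel₀ hw0
        rw [Rat.cast_zero] at hform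
        linear_combination hform
      exact hA (w.eq_zero_of_linear h1).1
    have hformp : (A : ℂ_[p]) * (ιp w) ^ 2 + (B : ℂ_[p]) * ιp w + (C : ℂ_[p]) = 0 := by
      have h := congrArg ιp hform
      simpa only [map_add, map_mul, map_pow, map_ratCast, map_zero] using h
    obtain ⟨nA, nB, nC⟩ := hN (ιp w) A B C hA hlev hformp hdisc
    have hAC := w.coeff_mul_nonpos hA hform hinter
    have hA1 := inv_pow_le_abs_of_norm_le hAm hA nA
    have hC1 := inv_pow_le_abs_of_norm_le hCm hC nC
    have hprod : |A| * |C| = -(A * C) := by rw [← abs_mul, abs_of_nonpos hAC]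
    have hΔle := le_abs_self Δ
    have hB2 : B ^ 2 ≤ |Δ| := by nlinarith
    have hACle : |A| * |C| ≤ |Δ| := by nlinarith [sq_nonneg B]
    have hpN : 1 ≤ (p : ℚ) ^ N := one_le_pow₀ (by exact_mod_cast hp.out.one_le)
    -- Applied to `A` and `C` in both orders: a lower bound for one factor and an upper bound for
    -- the product bound the other factor.
    have hbound : ∀ u v : ℚ, 1 ≤ (p : ℚ) ^ N * |v| → |u| * |v| ≤ |Δ| → |u| ≤ R := by
      intro u v hv huv
      calc |u| ≤ |u| * ((p : ℚ) ^ N * |v|) := le_mul_of_one_le_right (abs_nonneg u) hv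
        _ = (p : ℚ) ^ N * (|u| * |v|) := by ring
        _ ≤ (p : ℚ) ^ N * (1 + |Δ|) := by gcongr; linarith
    have hRB : |B| ≤ R := by
      have h1 : |B| ≤ 1 + |Δ| := by
        rw [← sq_abs] at hB2
        nlinarith [sq_nonneg (|B| - 1), abs_nonneg B]
      exact h1.trans (le_mul_of_one_le_left (by positivity) hpN)
    refine Set.mem_biUnion (x := (A, B, C)) ⟨⟨hAm, nA, ?_⟩, ⟨hBm, nB, hRB⟩, ⟨hCm, nC, ?_⟩⟩ ⟨hA, hform⟩
    · exact hbound A C hC1 hACle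
    · exact hbound C A hA1 (by rwa [mul_comm])

theorem finite_truncSupport_zero_infty (D : RMDivisor p ιinf ιp) (l : ℕ)
    (a : OnePoint (ZMod p)) : (truncSupport D l a ((0 : ℚ) : OnePoint ℚ) ∞).Finite := by
  refine (D.support.finite_toSet.biUnion fun o _ => finite_orbit_level o l).subset ?_
  rintro w ⟨h1, h2, -, h3, -⟩
  exact Set.mem_biUnion (x := w.orbit) (Finsupp.mem_support_iff.2 h1) ⟨rfl, h2, h3⟩

end Finiteness

/-! ### Slash actions of the inverses of `(p a; 0 1)` and `(1 0; 0 p)` -/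

section Slash

variable {p : ℕ} [hp : Fact p.Prime]

theorem coe_matUpper_inv (a : ℤ) :
    ((matUpper p a)⁻¹ : GL (Fin 2) ℚ).1 = !![(p : ℚ)⁻¹, -a / p; 0, 1] := by
  have hp0 : (p : ℚ) ≠ 0 := prime_ne_zero_rat
  have h : matUpper p a * Matrix.GeneralLinearGroup.mkOfDetNeZero
      !![(p : ℚ)⁻¹, -a / p; 0, 1] (by simpa using hp0) = 1 := by
    apply Units.ext
    change !![(p : ℚ), (a : ℚ); 0, 1] * !![(p : ℚ)⁻¹, -a / p; 0, 1] = 1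
    rw [Matrix.mul_fin_two, Matrix.one_fin_two]
    congr 1
    simp
    field_simp
    simp
  rw [inv_eq_of_mul_eq_one_right h]
  rfl

theorem coe_matLower_inv :
    ((matLower p)⁻¹ : GL (Fin 2) ℚ).1 = !![1, 0; 0, (p : ℚ)⁻¹] := by
  have hp0 : (p : ℚ) ≠ 0 := prime_ne_zero_rat
  have h : matLower p * Matrix.GeneralLinearGroup.mkOfDetNeZero
      !![1, 0; 0, (p : ℚ)⁻¹] (by simpa using hp0) = 1 := by
    apply Units.ext
    change !![(1 : ℚ), 0; 0, (p : ℚ)] * !![1, 0; 0, (p : ℚ)⁻¹] = 1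
    rw [Matrix.mul_fin_two, Matrix.one_fin_two]
    simp [hp0]
  rw [inv_eq_of_mul_eq_one_right h]
  rfl

/-- The determinant `p⁻¹` to the power `-h` gives `p^h`, and the automorphy factor is `1`. -/
theorem slashSymbol_matUpper_inv {h k : ℕ} (hk : k = 2 * h + 2) (a : ℤ)
    (m : OnePoint ℚ → OnePoint ℚ → ℂ_[p] → ℂ_[p]) (z : ℂ_[p]) :
    slashSymbol (2 - (k : ℤ)) m (matUpper p a)⁻¹ ((0 : ℚ) : OnePoint ℚ) ∞ z
      = (p : ℂ_[p]) ^ h * m ((-a / p : ℚ) : OnePoint ℚ) ∞ ((z - a) / p) := by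
  have hp0 : (p : ℂ_[p]) ≠ 0 := prime_ne_zero
  have hκ : (2 - (k : ℤ)) / 2 = -(h : ℤ) := by omega
  rw [slashSymbol, slashFun, OnePoint.smul_some_eq_ite, OnePoint.smul_infty_eq_ite, mobius,
    coe_matUpper_inv, Matrix.det_fin_two_of, hκ]
  simp
  left
  congr 1
  field_simp
  ring

/-- The determinant gives `p^h` and the automorphy factor `p^{-2h}`. -/
theorem slashSymbol_matLower_inv {h k : ℕ} (hk : k = 2 * h + 2)
    (m : OnePoint ℚ → OnePoint ℚ → ℂ_[p] → ℂ_[p]) (z : ℂ_[p]) :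
    slashSymbol (2 - (k : ℤ)) m (matLower p)⁻¹ ((0 : ℚ) : OnePoint ℚ) ∞ z
      = ((p : ℂ_[p]) ^ h)⁻¹ * m ((0 : ℚ) : OnePoint ℚ) ∞ (p * z) := by
  have hp0 : (p : ℂ_[p]) ≠ 0 := prime_ne_zero
  have hpQ : (p : ℚ) ≠ 0 := prime_ne_zero_rat
  have hκ : (2 - (k : ℤ)) / 2 = -(h : ℤ) := by omega
  have hκ' : -(2 - (k : ℤ)) = ((2 * h : ℕ) : ℤ) := by omega
  rw [slashSymbol, slashFun, OnePoint.smul_some_eq_ite, OnePoint.smul_infty_eq_ite, mobius,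
    coe_matLower_inv, Matrix.det_fin_two_of, hκ, hκ', zpow_natCast]
  have key : (p : ℂ_[p]) ^ h * ((p : ℂ_[p]) ^ (2 * h))⁻¹ = ((p : ℂ_[p]) ^ h)⁻¹ := by
    rw [two_mul, pow_add]
    field_simp
  simp [hp.out.ne_zero, mul_comm z, key]

end Slash

/-! ### Transport of the support -/

section Transport

variable {p : ℕ} [hp : Fact p.Prime] {ιinf : Qbar →+* ℂ} {ιp : Qbar →+* ℂ_[p]}

/-- The RM-point `p w + a`. -/
abbrev RMPoint.mulPAdd (w : RMPoint p ιinf ιp) (a : ℤ) : RMPoint p ιinf ιp :=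
  w.affine p prime_ne_zero_rat a

theorem RMPoint.embed_mulPAdd (w : RMPoint p ιinf ιp) (a : ℤ) :
    ιp (w.mulPAdd a) = (p : ℂ_[p]) * ιp w + (a : ℂ_[p]) := by
  rw [RMPoint.coe_affine, map_add, map_mul, map_ratCast, map_ratCast]
  simp

theorem RMPoint.embed_ne_zero (w : RMPoint p ιinf ιp) : ιp w ≠ 0 := by
  rw [Ne, map_eq_zero]
  simpa using w.ne_rat 0

theorem RMPoint.inter_mulPAdd (w : RMPoint p ιinf ιp) (a : ℤ) :
    (w.mulPAdd a).inter ((0 : ℚ) : OnePoint ℚ) ∞ = w.inter ((-a / p : ℚ) : OnePoint ℚ) ∞ := by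
  have hp0 : (0 : ℚ) < p := by exact_mod_cast hp.out.pos
  rw [← w.inter_affine hp0 a]
  congr 2
  field_simp
  ring

theorem prime_mul_add_mem_unramK_iff (a : ℤ) (x : ℂ_[p]) :
    (p : ℂ_[p]) * x + (a : ℂ_[p]) ∈ unramK p ↔ x ∈ unramK p := by
  have h := affine_mem_unramK_iff (p := p) (q := (p : ℚ)) (prime_ne_zero_rat (p := p)) a x
  rwa [Rat.cast_natCast, Rat.cast_intCast] at h

/-- The union over `b` is the condition `|w| ≤ 1`, since an integral point of positive level has a
residue in `𝔽_p`. -/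
theorem mulPAdd_mem_truncSupport_iff (D : RMDivisor p ιinf ιp) (l : ℕ) (a : ℤ)
    (w : RMPoint p ιinf ιp) :
    w.mulPAdd a ∈ truncSupport (-(varpi D)) (l + 1 + 1) ((a : ZMod p) : OnePoint (ZMod p))
        ((0 : ℚ) : OnePoint ℚ) ∞ ↔
      ∃ b : ZMod p, w ∈ truncSupport D (l + 1) b ((-a / p : ℚ) : OnePoint ℚ) ∞ := by
  have h := hasLevel_affine_iff a (x := ιp w) l.succ_ne_zero
  simp only [truncSupport, Set.mem_ofPred_eq, RMPoint.orbit_affine, neg_varpi_mulP,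
    RMPoint.inter_mulPAdd, prime_mul_add_mem_unramK_iff, reduces_intCast_iff,
    RMPoint.embed_mulPAdd]
  rw [← h]
  constructor
  · rintro ⟨h1, h2, h3, h4, h5⟩
    obtain ⟨b, hb⟩ := exists_reduces h4 l.succ_ne_zero h5
    exact ⟨b, h1, h2, h3, h5, hb⟩
  · rintro ⟨b, h1, h2, h3, h5, hb⟩
    exact ⟨h1, h2, h3, norm_le_one_of_reduces hb, h5⟩

theorem neg_varpi_apply (D : RMDivisor p ιinf ιp) (o : RMOrbit p ιinf ιp) :
    (-(varpi D)) o = D (RMOrbit.mulP o) := by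
  have h := neg_varpi_mulP D (RMOrbit.mulP o)
  rwa [mulP_mulP] at h

/-- The condition on `p w` is `|p w| ≥ 1`: the strict inequality is reduction to `∞`, the equality
is reduction to a nonzero class. -/
theorem mem_truncSupport_infty_iff (D : RMDivisor p ιinf ιp) (l : ℕ) (w : RMPoint p ιinf ιp) :
    w ∈ truncSupport (-(varpi D)) (l + 1 + 1) ∞ ((0 : ℚ) : OnePoint ℚ) ∞ ↔
      w.mulPAdd 0 ∈ truncSupport D (l + 1) ∞ ((0 : ℚ) : OnePoint ℚ) ∞ ∨
      ∃ b ∈ Finset.univ.erase (0 : ZMod p),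
        w.mulPAdd 0 ∈ truncSupport D (l + 1) b ((0 : ℚ) : OnePoint ℚ) ∞ := by
  have h := hasLevel_prime_mul_iff w.embed_ne_zero l.succ_ne_zero
  have hinter := w.inter_mulPAdd 0
  rw [Int.cast_zero, neg_zero, zero_div] at hinter
  have hembed := w.embed_mulPAdd 0
  rw [Int.cast_zero, add_zero] at hembed
  have hK := prime_mul_add_mem_unramK_iff 0 (ιp w)
  rw [Int.cast_zero, add_zero] at hK
  simp only [truncSupport, Set.mem_ofPred_eq, RMPoint.orbit_affine, neg_varpi_apply, hinter,
    hembed, hK]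
  rw [← h]
  constructor
  · rintro ⟨h1, h2, h3, h4, h5⟩
    rcases h4.lt_or_eq with hlt | heq
    · exact Or.inl ⟨h1, h2, h3, h5, hlt⟩
    · obtain ⟨b, hb⟩ := exists_reduces heq.ge l.succ_ne_zero h5
      refine Or.inr ⟨b, Finset.mem_erase.2 ⟨?_, Finset.mem_univ b⟩, h1, h2, h3, h5, hb⟩
      rintro rfl
      have hb' : ‖(p : ℂ_[p]) * ιp w - ((0 : ZMod p).val : ℂ_[p])‖ < 1 := hb
      rw [ZMod.val_zero, Nat.cast_zero, sub_zero, ← heq] at hb'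
      exact lt_irrefl _ hb'
  · rintro (⟨h1, h2, h3, h5, hlt⟩ | ⟨b, hb0, h1, h2, h3, h5, hb⟩)
    · exact ⟨h1, h2, h3, (show (1 : ℝ) < _ from hlt).le, h5⟩
    · refine ⟨h1, h2, h3, ?_, h5⟩
      by_contra hlt
      rw [not_le] at hlt
      refine (Finset.mem_erase.1 hb0).1 (reduces_unique hb ?_)
      change ‖(p : ℂ_[p]) * ιp w - ((0 : ZMod p).val : ℂ_[p])‖ < 1
      rwa [ZMod.val_zero, Nat.cast_zero, sub_zero]

theorem not_reduces_infty_of_reduces {x : ℂ_[p]} {b : ZMod p} (hb : Reduces x b) :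
    ¬ Reduces x ∞ := fun h => absurd (norm_le_one_of_reduces hb) (not_le.2 h)

end Transport

/-! ### Comparison of the logarithmic kernels -/

section Comparison

open Topology

variable {p : ℕ} [hp : Fact p.Prime] {ιinf : Qbar →+* ℂ} {ιp : Qbar →+* ℂ_[p]}

theorem pointPairing_congr (n : ℕ) {f g : ℂ_[p] → ℂ_[p]} {w : RMPoint p ιinf ιp}
    (h : f =ᶠ[𝓝 (ιp w)] g) : pointPairing n f w = pointPairing n g w :=
  polyPairing_taylorPoly_congr (natDegree_poly_le n w) h

theorem pointPairing_mulPAdd (h : ℕ) (w : RMPoint p ιinf ιp) (a : ℤ) {G g : ℂ_[p] → ℂ_[p]}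
    (hG : (fun t => G ((p : ℂ_[p]) * t + (a : ℂ_[p]))) =ᶠ[𝓝 (ιp w)]
      fun t => (p : ℂ_[p]) ^ (2 * h) * g t) :
    pointPairing (2 * h) G (w.mulPAdd a) = (p : ℂ_[p]) ^ h * pointPairing (2 * h) g w := by
  have hp0 : (p : ℂ_[p]) ≠ 0 := prime_ne_zero
  have h1 := pointPairing_affine (2 * h) w p prime_ne_zero_rat a G
  rw [Rat.cast_natCast, Rat.cast_intCast, pointPairing_congr _ hG, Nat.mul_div_cancel_left _ two_pos,
    pointPairing, pointPairing, polyPairing_taylorPoly_const_mul (natDegree_poly_le _ w)] at h1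
  apply mul_left_cancel₀ (pow_ne_zero (2 * h) hp0)
  rw [pointPairing, pointPairing]
  linear_combination h1

theorem logBranch_prime_mul' (x : ℂ_[p]) : logBranch 0 ((p : ℂ_[p]) * x) = logBranch 0 x := by
  rcases eq_or_ne x 0 with rfl | hx
  · rw [mul_zero]
  · exact logBranch_prime_mul hx

theorem pointPairing_logKernel_mulPAdd (h : ℕ) (w : RMPoint p ιinf ιp) (a : ℤ)
    (hw : ‖ιp w‖ ≤ 1) (z : ℂ_[p]) :
    pointPairing (2 * h) (logKernel (2 * h) z) (w.mulPAdd a)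
      = (p : ℂ_[p]) ^ h * pointPairing (2 * h) (logKernel (2 * h) ((z - (a : ℂ_[p])) / (p : ℂ_[p]))) w := by
  have hp0 : (p : ℂ_[p]) ≠ 0 := prime_ne_zero
  refine pointPairing_mulPAdd h w a ?_
  filter_upwards [eventually_norm_le_one hw] with t ht
  have ht' : ‖(p : ℂ_[p]) * t + (a : ℂ_[p])‖ ≤ 1 := by
    refine (IsUltrametricDist.norm_add_le_max _ _).trans (max_le ?_ (norm_intCast_le_one a))
    rw [norm_mul]
    exact mul_le_one₀ (IsUltrametricDist.norm_natCast_le_one _ _) (norm_nonneg _) ht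
  have e : (p : ℂ_[p]) * t + (a : ℂ_[p]) - z = p * (t - (z - a) / p) := by
    field_simp
    ring
  rw [logKernel, logKernel, if_pos ht', if_pos ht, e, logBranch_prime_mul', mul_pow, mul_assoc]

theorem pointPairing_logKernel_mulP_of_lt (h : ℕ) (w : RMPoint p ιinf ιp)
    (hw : 1 < ‖(p : ℂ_[p]) * ιp w‖) (z : ℂ_[p]) :
    pointPairing (2 * h) (logKernel (2 * h) ((p : ℂ_[p]) * z)) (w.mulPAdd 0)
      = (p : ℂ_[p]) ^ h * pointPairing (2 * h) (logKernel (2 * h) z) w := by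
  have hp0 : (p : ℂ_[p]) ≠ 0 := prime_ne_zero
  refine pointPairing_mulPAdd h w 0 ?_
  have hc : ContinuousAt (fun t : ℂ_[p] => ‖(p : ℂ_[p]) * t‖) (ιp w) := by fun_prop
  filter_upwards [hc.eventually_const_lt hw] with t ht
  have ht' : 1 < ‖t‖ := by
    refine ht.trans_le ?_
    rw [norm_mul]
    exact mul_le_of_le_one_left (norm_nonneg _) (IsUltrametricDist.norm_natCast_le_one _ _)
  rw [logKernel, logKernel, Int.cast_zero, add_zero, if_neg (not_le.2 ht), if_neg (not_le.2 ht'),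
    ← mul_sub, mul_pow, mul_assoc, mul_div_mul_left _ _ hp0]

/-- The points `w` and `p w` lie on different sides of the case distinction in the kernel; the
additional `log_0 t` is the only source of the polynomial in part (2). -/
theorem pointPairing_logKernel_mulP_of_eq (h : ℕ) (w : RMPoint p ιinf ιp)
    (hw : ‖(p : ℂ_[p]) * ιp w‖ = 1) {z : ℂ_[p]} (hz : ιp w ≠ z) :
    pointPairing (2 * h) (logKernel (2 * h) ((p : ℂ_[p]) * z)) (w.mulPAdd 0)
      = (p : ℂ_[p]) ^ h * (pointPairing (2 * h) (logKernel (2 * h) z) w +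
        pointPairing (2 * h) (fun t => (t - z) ^ (2 * h) * logBranch 0 t) w) := by
  have hp0 : (p : ℂ_[p]) ≠ 0 := prime_ne_zero
  have hpR : (0 : ℝ) < (p : ℝ)⁻¹ := by
    have := one_lt_prime_real (p := p)
    positivity
  have hw1 : 1 < ‖ιp w‖ := by
    by_contra hle
    rw [norm_prime_mul] at hw
    have := inv_lt_one_of_one_lt₀ (one_lt_prime_real (p := p))
    nlinarith
  have hpow : AnalyticAt ℂ_[p] (fun t : ℂ_[p] => (t - z) ^ (2 * h)) (ιp w) := by fun_prop
  rw [pointPairing_mulPAdd h w 0 (g := fun t => logKernel (2 * h) z t +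
    (t - z) ^ (2 * h) * logBranch 0 t)]
  · congr 1
    exact polyPairing_taylorPoly_add (natDegree_poly_le _ w) (analyticAt_logKernel _ hz)
      (hpow.mul (analyticAt_logBranch w.embed_ne_zero))
  · have hc : ContinuousAt (fun t : ℂ_[p] => (p : ℂ_[p]) * t) (ιp w) := by fun_prop
    filter_upwards [hc.eventually (eventually_norm_le_one hw.le),
      continuous_norm.continuousAt.eventually_const_lt hw1, eventually_ne_nhds hz] with t ht ht' htz
    have ht0 : t ≠ 0 := by
      rintro rfl
      rw [norm_zero] at ht'
      linarith
    have h1 : 1 - z / t ≠ 0 := by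
      rw [Ne, sub_eq_zero, eq_div_iff ht0, one_mul]
      exact htz
    have e : t - z = (1 - z / t) * t := by field_simp
    have hlog : logBranch 0 (t - z) = logBranch 0 (1 - z / t) + logBranch 0 t := by
      rw [← logBranch_mul h1 ht0, ← e]
    rw [logKernel, logKernel, Int.cast_zero, add_zero, if_pos ht, if_neg (not_le.2 ht'), ← mul_sub,
      logBranch_prime_mul', hlog, mul_pow]
    ring

theorem exists_polynomial_pointPairing (n : ℕ) {g : ℂ_[p] → ℂ_[p]} (w : RMPoint p ιinf ιp)
    (hg : AnalyticAt ℂ_[p] g (ιp w)) : ∃ Q : ℂ_[p][X], Q.natDegree ≤ n ∧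
      ∀ z, pointPairing n (fun t => (t - z) ^ n * g t) w = Q.eval z := by
  refine ⟨∑ m ∈ Finset.range (n + 1), Polynomial.C ((-1) ^ (n - m) * (n.choose m : ℂ_[p]) *
    pointPairing n (fun t => t ^ m * g t) w) * Polynomial.X ^ (n - m), ?_, fun z => ?_⟩
  · refine Polynomial.natDegree_sum_le_of_forall_le _ _ fun m _ => ?_
    exact (Polynomial.natDegree_C_mul_X_pow_le _ _).trans (Nat.sub_le n m)
  · have hterm : ∀ m : ℕ, AnalyticAt ℂ_[p] (fun t => t ^ m * g t) (ιp w) := fun m =>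
      (analyticAt_id.pow m).mul hg
    have e : (fun t => (t - z) ^ n * g t) = fun t => ∑ m ∈ Finset.range (n + 1),
        ((-z) ^ (n - m) * (n.choose m : ℂ_[p])) * (t ^ m * g t) := by
      funext t
      rw [sub_eq_add_neg, add_pow, Finset.sum_mul]
      refine Finset.sum_congr rfl fun m _ => ?_
      ring
    rw [e, pointPairing, polyPairing_taylorPoly_sum (natDegree_poly_le n w) _
      (f := fun m t => ((-z) ^ (n - m) * (n.choose m : ℂ_[p])) * (t ^ m * g t))
      fun m _ => analyticAt_const.mul (hterm m), Polynomial.eval_finsetSum]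
    refine Finset.sum_congr rfl fun m _ => ?_
    rw [polyPairing_taylorPoly_const_mul (natDegree_poly_le n w)]
    simp only [Polynomial.eval_mul, Polynomial.eval_C, Polynomial.eval_pow, Polynomial.eval_X,
      pointPairing]
    rw [neg_pow z]
    ring

end Comparison

/-! ### The recursion for the truncated primitives -/

section Recursion

variable {p : ℕ} [hp : Fact p.Prime] {ιinf : Qbar →+* ℂ} {ιp : Qbar →+* ℂ_[p]}

theorem truncSupport_disjoint (D : RMDivisor p ιinf ιp) (l : ℕ) {b c : ZMod p} (hbc : b ≠ c)
    (r s : OnePoint ℚ) : Disjoint (truncSupport D l b r s) (truncSupport D l c r s) :=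
  Set.disjoint_left.2 fun _ hw hw' => hbc (reduces_unique hw.2.2.2.2 hw'.2.2.2.2)

theorem coeff_mulPAdd (D : RMDivisor p ιinf ιp) (w : RMPoint p ιinf ιp) (a : ℤ) :
    (-(varpi D)) (w.mulPAdd a).orbit * (w.mulPAdd a).inter ((0 : ℚ) : OnePoint ℚ) ∞
      = D w.orbit * w.inter ((-a / p : ℚ) : OnePoint ℚ) ∞ := by
  rw [RMPoint.orbit_affine, neg_varpi_mulP, RMPoint.inter_mulPAdd]

theorem coeff_mulP (D : RMDivisor p ιinf ιp) (w : RMPoint p ιinf ιp) :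
    D (w.mulPAdd 0).orbit * (w.mulPAdd 0).inter ((0 : ℚ) : OnePoint ℚ) ∞
      = (-(varpi D)) w.orbit * w.inter ((0 : ℚ) : OnePoint ℚ) ∞ := by
  rw [RMPoint.orbit_affine, neg_varpi_apply, RMPoint.inter_mulPAdd, Int.cast_zero, neg_zero,
    zero_div]

theorem F_neg_varpi_finite {h k : ℕ} (hk : k = 2 * h + 2) (D : RMDivisor p ιinf ιp) (l : ℕ)
    (a : ℤ) {z : ℂ_[p]} (hz : z ∉ unramK p) :
    F k (-(varpi D)) (l + 1) ((a : ZMod p) : OnePoint (ZMod p)) ((0 : ℚ) : OnePoint ℚ) ∞ z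
      = ∑ b : ZMod p, slashSymbol (2 - (k : ℤ)) (F k D l (b : OnePoint (ZMod p)))
            (matUpper p a)⁻¹ ((0 : ℚ) : OnePoint ℚ) ∞ z := by
  have hn : k - 2 = 2 * h := by omega
  have hp0 : (p : ℂ_[p]) ≠ 0 := prime_ne_zero
  set S' := truncSupport (-(varpi D)) (l + 1 + 1) ((a : ZMod p) : OnePoint (ZMod p))
    ((0 : ℚ) : OnePoint ℚ) ∞ with hS'
  let S : ZMod p → Set (RMPoint p ιinf ιp) := fun b =>
    truncSupport D (l + 1) b ((-a / p : ℚ) : OnePoint ℚ) ∞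
  have hS'fin : S'.Finite := finite_truncSupport_zero_infty _ _ _
  have hinj := RMPoint.affine_injective (ιinf := ιinf) (ιp := ιp) p prime_ne_zero_rat a
  have hsurj := RMPoint.affine_surjective (ιinf := ιinf) (ιp := ιp) p prime_ne_zero_rat a
  -- The substitution embeds these points, for the path from `-a/p`, into the set already known to
  -- be finite for the path from `0`.
  have hSfin : ∀ b, (S b).Finite := fun b =>
    (hS'fin.preimage hinj.injOn).subset fun w hw =>
      (mulPAdd_mem_truncSupport_iff D l a w).2 ⟨b, hw⟩
  have hbij : Set.BijOn (fun w : RMPoint p ιinf ιp => w.mulPAdd a) (⋃ b, S b) S' := by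
    refine ⟨fun w hw => ?_, hinj.injOn, fun w' hw' => ?_⟩
    · exact (mulPAdd_mem_truncSupport_iff D l a w).2 (Set.mem_iUnion.1 hw)
    · obtain ⟨w, rfl⟩ := hsurj w'
      exact ⟨w, Set.mem_iUnion.2 ((mulPAdd_mem_truncSupport_iff D l a w).1 hw'), rfl⟩
  have hz' : (z - (a : ℂ_[p])) / (p : ℂ_[p]) ∉ unramK p := by
    rw [← prime_mul_add_mem_unramK_iff a]
    have e : (p : ℂ_[p]) * ((z - a) / p) + a = z := by
      field_simp
      ring
    rwa [e]
  rw [F_eq_finsum _ _ _ _ _ _ hS'fin hz]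
  simp_rw [slashSymbol_matUpper_inv hk]
  rw [Finset.sum_congr rfl fun b _ => by rw [F_eq_finsum _ _ _ _ _ _ (hSfin b) hz'], ← hS', hn]
  rw [← finsum_mem_eq_of_bijOn (f := fun w : RMPoint p ιinf ιp => (p : ℂ_[p]) ^ h *
      (((D w.orbit * w.inter ((-a / p : ℚ) : OnePoint ℚ) ∞ : ℤ) : ℂ_[p]) *
        pointPairing (2 * h) (logKernel (2 * h) ((z - (a : ℂ_[p])) / (p : ℂ_[p]))) w)) _ hbij,
    finsum_mem_iUnion (fun b c hbc => truncSupport_disjoint D (l + 1) hbc _ _) hSfin,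
    finsum_eq_sum_of_fintype]
  · refine Finset.sum_congr rfl fun b _ => ?_
    rw [mul_finsum_mem]
  · intro w hw
    obtain ⟨b, hb⟩ := Set.mem_iUnion.1 hw
    rw [coeff_mulPAdd, pointPairing_logKernel_mulPAdd h w a (norm_le_one_of_reduces hb.2.2.2.2)]
    ring

theorem F_neg_varpi_infty {h k : ℕ} (hk : k = 2 * h + 2) (D : RMDivisor p ιinf ιp) (l : ℕ) :
    ∃ P : ℂ_[p][X], P.natDegree ≤ k - 2 ∧ ∀ z : ℂ_[p], z ∉ unramK p →
      F k (-(varpi D)) (l + 1) ∞ ((0 : ℚ) : OnePoint ℚ) ∞ z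
        - slashSymbol (2 - (k : ℤ)) (F k D l ∞) (matLower p)⁻¹ ((0 : ℚ) : OnePoint ℚ) ∞ z
        - ∑ b ∈ Finset.univ.erase (0 : ZMod p),
            slashSymbol (2 - (k : ℤ)) (F k D l (b : OnePoint (ZMod p)))
              (matLower p)⁻¹ ((0 : ℚ) : OnePoint ℚ) ∞ z
        = P.eval z := by
  have hn : k - 2 = 2 * h := by omega
  have hp0 : (p : ℂ_[p]) ≠ 0 := prime_ne_zero
  rw [hn]
  have hinj := RMPoint.affine_injective (ιinf := ιinf) (ιp := ιp) p prime_ne_zero_rat (0 : ℤ)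
  have hsurj := RMPoint.affine_surjective (ιinf := ιinf) (ιp := ιp) p prime_ne_zero_rat (0 : ℤ)
  let B : RMPoint p ιinf ιp → RMPoint p ιinf ιp := fun w => w.mulPAdd 0
  let S : OnePoint (ZMod p) → Set (RMPoint p ιinf ιp) := fun b =>
    truncSupport D (l + 1) b ((0 : ℚ) : OnePoint ℚ) ∞
  have hSfin : ∀ b, (S b).Finite := fun b => finite_truncSupport_zero_infty _ _ _
  let T : OnePoint (ZMod p) → Set (RMPoint p ιinf ιp) := fun b => B ⁻¹' S b
  have hTfin : ∀ b, (T b).Finite := fun b => (hSfin b).preimage hinj.injOn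
  have hbij : ∀ b, Set.BijOn B (T b) (S b) := fun b =>
    ⟨fun w hw => hw, hinj.injOn, fun w' hw' => by
      obtain ⟨w, rfl⟩ := hsurj w'
      exact ⟨w, hw', rfl⟩⟩
  have hunion : truncSupport (-(varpi D)) (l + 1 + 1) ∞ ((0 : ℚ) : OnePoint ℚ) ∞
      = T ∞ ∪ ⋃ b ∈ (↑(Finset.univ.erase (0 : ZMod p)) : Set (ZMod p)), T b := by
    ext w
    rw [mem_truncSupport_infty_iff]
    simp only [Set.mem_union, Set.mem_iUnion₂, exists_prop, Finset.mem_coe]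
    rfl
  have hdisj : Disjoint (T ∞) (⋃ b ∈ (↑(Finset.univ.erase (0 : ZMod p)) : Set (ZMod p)), T b) := by
    refine Set.disjoint_left.2 fun w hw hw' => ?_
    obtain ⟨b, -, hb⟩ := Set.mem_iUnion₂.1 hw'
    exact not_reduces_infty_of_reduces hb.2.2.2.2 hw.2.2.2.2
  have hpair : (↑(Finset.univ.erase (0 : ZMod p)) : Set (ZMod p)).PairwiseDisjoint
      fun b => T (b : OnePoint (ZMod p)) := fun b _ c _ hbc =>
    (truncSupport_disjoint D (l + 1) hbc _ _).preimage B
  have hQ : ∀ w : RMPoint p ιinf ιp, ∃ Q : ℂ_[p][X], Q.natDegree ≤ 2 * h ∧ ∀ z,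
      pointPairing (2 * h) (fun t => (t - z) ^ (2 * h) * logBranch 0 t) w = Q.eval z := fun w =>
    exists_polynomial_pointPairing (2 * h) w (analyticAt_logBranch w.embed_ne_zero)
  choose Q hQdeg hQeval using hQ
  let c : RMPoint p ιinf ιp → ℤ := fun w =>
    (-(varpi D)) w.orbit * w.inter ((0 : ℚ) : OnePoint ℚ) ∞
  -- The sum of the `log_0 t` terms over the points with `|p w| = 1`; the sign is negative because
  -- they occur in the subtracted slash terms.
  refine ⟨-∑ b ∈ Finset.univ.erase (0 : ZMod p), ∑ w ∈ (hTfin b).toFinset,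
    Polynomial.C (c w : ℂ_[p]) * Q w, ?_, fun z hz => ?_⟩
  · rw [Polynomial.natDegree_neg]
    refine Polynomial.natDegree_sum_le_of_forall_le _ _ fun b _ => ?_
    refine Polynomial.natDegree_sum_le_of_forall_le _ _ fun w _ => ?_
    exact (Polynomial.natDegree_C_mul_le _ _).trans (hQdeg w)
  have hpz : (p : ℂ_[p]) * z ∉ unramK p := by
    have h := prime_mul_add_mem_unramK_iff (p := p) 0 z
    rw [Int.cast_zero, add_zero] at h
    rwa [h]
  have hslash : ∀ b, slashSymbol (2 - (k : ℤ)) (F k D l b) (matLower p)⁻¹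
      ((0 : ℚ) : OnePoint ℚ) ∞ z = ∑ w ∈ (hTfin b).toFinset, ((p : ℂ_[p]) ^ h)⁻¹ * ((c w : ℂ_[p]) *
        pointPairing (2 * h) (logKernel (2 * h) ((p : ℂ_[p]) * z)) (B w)) := by
    intro b
    rw [slashSymbol_matLower_inv hk, F_eq_finsum _ _ _ _ _ _ (hSfin b) hpz, hn,
      ← finsum_mem_eq_finite_toFinset_sum _ (hTfin b), ← mul_finsum_mem]
    congr 1
    refine (finsum_mem_eq_of_bijOn B (hbij b) fun w _ => ?_).symm
    rw [coeff_mulP]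
  have hF : F k (-(varpi D)) (l + 1) ∞ ((0 : ℚ) : OnePoint ℚ) ∞ z
      = ∑ w ∈ (hTfin ∞).toFinset,
          (c w : ℂ_[p]) * pointPairing (2 * h) (logKernel (2 * h) z) w +
        ∑ b ∈ Finset.univ.erase (0 : ZMod p), ∑ w ∈ (hTfin b).toFinset,
          (c w : ℂ_[p]) * pointPairing (2 * h) (logKernel (2 * h) z) w := by
    rw [F_eq_finsum _ _ _ _ _ _ (finite_truncSupport_zero_infty _ _ _) hz, hn, hunion,
      finsum_mem_union hdisj (hTfin ∞) (Set.Finite.biUnion (Finset.finite_toSet _) fun b _ => hTfin b),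
      finsum_mem_biUnion hpair (Finset.finite_toSet _) (fun b _ => hTfin b), finsum_mem_coe_finset,
      finsum_mem_eq_finite_toFinset_sum _ (hTfin ∞)]
    congr 1
    exact Finset.sum_congr rfl fun b _ => finsum_mem_eq_finite_toFinset_sum _ (hTfin b)
  have hinfty : ∀ w ∈ (hTfin ∞).toFinset, ((p : ℂ_[p]) ^ h)⁻¹ * ((c w : ℂ_[p]) *
      pointPairing (2 * h) (logKernel (2 * h) ((p : ℂ_[p]) * z)) (B w))
      = (c w : ℂ_[p]) * pointPairing (2 * h) (logKernel (2 * h) z) w := by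
    intro w hw
    have hred : 1 < ‖ιp (w.mulPAdd 0)‖ := ((hTfin ∞).mem_toFinset.1 hw).2.2.2.2
    rw [w.embed_mulPAdd 0, Int.cast_zero, add_zero] at hred
    rw [pointPairing_logKernel_mulP_of_lt h w hred]
    field_simp
  have hfinite : ∀ b ∈ Finset.univ.erase (0 : ZMod p), ∀ w ∈ (hTfin b).toFinset,
      ((p : ℂ_[p]) ^ h)⁻¹ * ((c w : ℂ_[p]) *
      pointPairing (2 * h) (logKernel (2 * h) ((p : ℂ_[p]) * z)) (B w))
      = (c w : ℂ_[p]) * pointPairing (2 * h) (logKernel (2 * h) z) w +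
        (c w : ℂ_[p]) * (Q w).eval z := by
    intro b hb w hw
    have hmem := (hTfin b).mem_toFinset.1 hw
    have hle := norm_le_one_of_reduces hmem.2.2.2.2
    have hS' := (mem_truncSupport_infty_iff D l w).2 (Or.inr ⟨b, hb, hmem⟩)
    have hge := ((hasLevel_prime_mul_iff w.embed_ne_zero l.succ_ne_zero).2 hS'.2.2.2).1
    rw [w.embed_mulPAdd 0, Int.cast_zero, add_zero] at hle
    have hwz : ιp w ≠ z := by
      rintro rfl
      exact hz hS'.2.2.1
    rw [pointPairing_logKernel_mulP_of_eq h w (le_antisymm hle hge) hwz, hQeval]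
    field_simp
  rw [hF, hslash, Finset.sum_congr rfl hinfty, Finset.sum_congr rfl fun (b : ZMod p) _ => hslash (b : OnePoint (ZMod p)),
    Finset.sum_congr rfl fun b hb => Finset.sum_congr rfl (hfinite b hb)]
  simp only [Polynomial.eval_neg, Polynomial.eval_finsetSum, Polynomial.eval_mul, Polynomial.eval_C,
    Finset.sum_add_distrib]
  ring

end Recursion

end

end RMGreen

theorem mainTheorem9 (p : ℕ) [Fact p.Prime] (ιinf : Qbar →+* ℂ) (ιp : Qbar →+* ℂ_[p])
    (k : ℕ) (hk : Even k) (hk2 : 2 ≤ k) (D : RMDivisor p ιinf ιp) (l : ℕ) :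
    (∀ a : ℤ, ∃ P : ℂ_[p][X], P.natDegree ≤ k - 2 ∧ ∀ z : ℂ_[p], z ∉ unramK p →
      F k (-(varpi D)) (l + 1) ((a : ZMod p) : OnePoint (ZMod p)) ((0 : ℚ) : OnePoint ℚ) ∞ z
        - ∑ b : ZMod p, slashSymbol (2 - (k : ℤ)) (F k D l (b : OnePoint (ZMod p)))
            (matUpper p a)⁻¹ ((0 : ℚ) : OnePoint ℚ) ∞ z
        = P.eval z) ∧
    (∃ P : ℂ_[p][X], P.natDegree ≤ k - 2 ∧ ∀ z : ℂ_[p], z ∉ unramK p →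
      F k (-(varpi D)) (l + 1) ∞ ((0 : ℚ) : OnePoint ℚ) ∞ z
        - slashSymbol (2 - (k : ℤ)) (F k D l ∞) (matLower p)⁻¹ ((0 : ℚ) : OnePoint ℚ) ∞ z
        - ∑ b ∈ Finset.univ.erase (0 : ZMod p),
            slashSymbol (2 - (k : ℤ)) (F k D l (b : OnePoint (ZMod p)))
              (matLower p)⁻¹ ((0 : ℚ) : OnePoint ℚ) ∞ z
        = P.eval z) := by
  obtain ⟨h, hk'⟩ : ∃ h, k = 2 * h + 2 := by
    obtain ⟨m, rfl⟩ := hk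
    exact ⟨m - 1, by omega⟩
  refine ⟨fun a => ⟨0, by simp, fun z hz => ?_⟩, F_neg_varpi_infty hk' D l⟩
  rw [F_neg_varpi_finite hk' D l a hz, sub_self, Polynomial.eval_zero]
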